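/- **Setting.** Let $f=\frac1l\sum_{i=1}^l f_i$, where each $f_i:\mathbb R^N\to\mathbb R$ is differentiable (possibly nonconvex) and $\|\nabla f_i(x)-\nabla f_i(y)\|\le L\|x-y\|$ for all $x,y$. Let $\mu_1,\dots,\mu_N>0$, $1\le Y\le N$, and for $J\subseteq\{1,\dots,N\}$ put $$G_J(x;h)=\sum_{j\in J}\frac{N}{2Y\mu_j}\bigl(h(x+\mu_je_j)-h(x-\mu_je_j)\bigr)e_j .$$ Let $f^j(x)=\frac1{2\mu_j}\int_{-\mu_j}^{\mu_j}f(x+ve_j)\,dv$, let $M(x)=\sum_{j=1}^N\nabla_jf^j(x)$ with $\nabla_j h=\frac{\partial h}{\partial x_j}e_j$, and assume that $\|M(x)-M(y)\|\le\widetilde L\|x-y\|$ and $\|M(x)\|\le\widehat L\|\nabla f(x)\|$ for all $x,y$, where $L\ge 0$, $\widetilde L>0$, $\widehat L\ge0$. Put $\omega=\frac{L^2}{N}\sum_{j}\mu_j^2$. **AsyDSZOVR** (step size $\gamma$, batch size $b$, $S\ge1$ epochs, $m\ge1$ inner iterations, $T=Sm$). Start from a deterministic $x^0$. In epoch $s=0,\dots,S-1$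 put $\widetilde x^s=x_0^{s+1}=x^s$. For $t=0,\dots,m-1$, a value $\widehat x_t^{s+1}$ with $$x_t^{s+1}=\widehat x_t^{s+1}-\gamma\sum_{t'\in K(t)}B_{t'}^{s+1}\,\widehat v^{s+1}_{J(t')}$$ is read, where $K(t)\subseteq\{t':t-\tau\le t'\le t-1\}$ is a set of inner iterations of the same epoch and the $B_{t'}^{s+1}$ are diagonal $0/1$ matrices (both may depend on $t$, on $s$ and on the past). Then a mini-batch $\mathcal B(t)$ of $b$ indices from $\{1,\dots,l\}$ (with or without replacement) and a $Y$-element set $J(t)\subseteq\{1,\dots,N\}$ are drawn uniformly, independently of each other and of the past, including $\widehat x_t^{s+1}$, and $$\widehat v^{s+1}_{J(t)}=\frac1b\sum_{i\in\mathcal B(t)}\bigl(G_{J(t)}(\widehat x^{s+1}_t;f_i)-G_{J(t)}(\widetilde x^s;f_i)\bigr)+G_{J(t)}(\widetilde x^s;f),\qquad x^{s+1}_{t+1}=x^{s+1}_t-\gamma\,\widehat v^{s+1}_{J(t)}.$$ Finally $x^{s+1}=x^{s+1}_m$. **Parameters.** Let $0<\alpha<1$, $1\le b<l^\alpha$, $\gamma=\frac{u_0b}{\widetilde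 Ll^\alpha}$, $\beta_t=\frac{\widetilde LN^2}{Y}$, $1\le m\le\Bigl\lfloor\frac{Yl^\alpha}{5u_0bN^2}\Bigr\rfloor$, $c_m=0$ and, for $0\le t<m$, $$c_t=c_{t+1}(1+\gamma\beta_t)+\Bigl(\frac{c_{t+1}N\gamma^2}{Y}+\frac{LY\gamma^2}{2N}+\frac{\gamma^3NL^2\tau^2}{Y}\Bigr)\frac{4YN\widetilde L^2}{b(Y-2N\widetilde L^2\gamma^2\tau^2)},$$ $$\Gamma_t=\frac\gamma2-\Bigl(\frac{c_{t+1}N\gamma^2}{Y}+\frac{LY\gamma^2}{2N}+\frac{\gamma^3NL^2\tau^2}{Y}\Bigr)\frac{4Y\widehat L}{Y-2N\widetilde L^2\gamma^2\tau^2}.$$ **Theorem.** There is $u^*\in(0,1)$, depending only on $N,Y,\tau,L,\widetilde L,\widehat L$, such that for every $0<u_0\le u^*$ the following holds. 1. There is $\sigma_0>0$, depending only on $u_0,N,Y,\tau,L,\widetilde L,\widehat L$ (in particular not on $l,b,\alpha,m$), such that for all $\alpha,l,b,m$ as above $Y-2N\widetilde L^2\gamma^2\tau^2>0$ and $\Gamma_t\ge\frac{\sigma_0b}{\widetilde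 Ll^\alpha}$ for $0\le t<m$. 2. For every $\sigma>0$ with $\Gamma_t\ge\frac{\sigma b}{\widetilde Ll^\alpha}$ for all $0\le t<m$ (for example $\sigma=\sigma_0$), the expectations below exist and $$\frac1T\sum_{s=0}^{S-1}\sum_{t=0}^{m-1}\mathbb E\|\nabla f(x_t^{s+1})\|^2\le\frac{\widetilde Ll^\alpha\bigl(f(x^0)-\mathbb E f(x^S)\bigr)}{\sigma bT}+\frac{Nu_0\omega}{4\sigma}.$$ -/

import Mathlib

open MeasureTheory

noncomputable section

namespace AsyDSZOVR

/-- The `j`-th standard basis vector of `ℝ^N`. -/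
def stdVec {N : ℕ} (j : Fin N) : EuclideanSpace ℝ (Fin N) := EuclideanSpace.single j 1

/-- The objective `f = (1/l) ∑ᵢ fᵢ`. -/
def avg {N l : ℕ} (f : Fin l → EuclideanSpace ℝ (Fin N) → ℝ)
    (x : EuclideanSpace ℝ (Fin N)) : ℝ :=
  (1 / (l : ℝ)) * ∑ i, f i x

/-- The two-point gradient estimate of `h` at `x` on the coordinate set `J`:
`G_J(x;h) = ∑_{j ∈ J} N/(2 Y μ_j) (h(x + μ_j e_j) - h(x - μ_j e_j)) e_j`. -/
def G {N : ℕ} (Y : ℕ) (μ : Fin N → ℝ) (J : Finset (Fin N))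
    (x : EuclideanSpace ℝ (Fin N)) (h : EuclideanSpace ℝ (Fin N) → ℝ) :
    EuclideanSpace ℝ (Fin N) :=
  ∑ j ∈ J, (((N : ℝ) / (2 * Y * μ j)) *
    (h (x + μ j • stdVec j) - h (x - μ j • stdVec j))) • stdVec j

/-- The coordinate-smoothed function
`h^j(x) = (1/(2 μ_j)) ∫_{-μ_j}^{μ_j} h(x + v e_j) dv`. -/
def coordSmooth {N : ℕ} (μ : Fin N → ℝ) (h : EuclideanSpace ℝ (Fin N) → ℝ) (j : Fin N)
    (x : EuclideanSpace ℝ (Fin N)) : ℝ :=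
  (1 / (2 * μ j)) * ∫ v in (-μ j)..(μ j), h (x + v • stdVec j)

/-- The mixtured gradient `∑_j ∇_j h^j(x)`, where `∇_j` is the partial derivative in the
`j`-th coordinate, viewed as a multiple of `e_j`. -/
def mixedGrad {N : ℕ} (μ : Fin N → ℝ) (h : EuclideanSpace ℝ (Fin N) → ℝ)
    (x : EuclideanSpace ℝ (Fin N)) : EuclideanSpace ℝ (Fin N) :=
  ∑ j, (lineDeriv ℝ (coordSmooth μ h j) x (stdVec j)) • stdVec j

/-- `ω = L² (∑_j μ_j²) / N`. -/
def smoothingBias {N : ℕ} (L : ℝ) (μ : Fin N → ℝ) : ℝ := L ^ 2 * (∑ j, μ j ^ 2) / N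

/-- The variance-reduced direction
`v = (1/b) ∑_{i ∈ B} G_J(xh;f_i) - (1/b) ∑_{i ∈ B} G_J(xt;f_i) + G_J(xt;f)`,
where the mini-batch `B` is listed as a tuple of `b` indices. -/
def direction {N l b : ℕ} (Y : ℕ) (μ : Fin N → ℝ)
    (f : Fin l → EuclideanSpace ℝ (Fin N) → ℝ) (B : Fin b → Fin l) (J : Finset (Fin N))
    (xh xt : EuclideanSpace ℝ (Fin N)) : EuclideanSpace ℝ (Fin N) :=
  (1 / (b : ℝ)) • (∑ i, G Y μ J xh (f (B i))) - (1 / (b : ℝ)) • (∑ i, G Y μ J xt (f (B i)))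
    + G Y μ J xt (avg f)

/-- Multiplication by the diagonal matrix with `j`-th entry `1` if `j ∈ A` and `0` otherwise. -/
def mask {N : ℕ} (A : Finset (Fin N)) (v : EuclideanSpace ℝ (Fin N)) :
    EuclideanSpace ℝ (Fin N) :=
  WithLp.toLp 2 (fun j => if j ∈ A then v j else 0)

/-- The two usual ways to draw a mini-batch of size `b` from `{1,…,l}` with equal probability:
uniformly with replacement (all `b`-tuples), or uniformly without replacement (all `b`-tuples of
distinct indices; their underlying sets are the uniformly distributed `b`-subsets). -/
def IsBatchSpace {l b : ℕ} (batches : Finset (Fin b → Fin l)) : Prop :=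
  (∀ B, B ∈ batches) ∨ (∀ B, B ∈ batches ↔ Function.Injective B)

/-- The random inputs of `S` epochs of `m` inner iterations.  Inner iteration `t` of epoch `s` has
number `s * m + t`, and `ℱ (s * m + t)` is the information available when its read has been made.
* `batch s t`, `coords s t`: the mini-batch and the coordinate set drawn in that iteration;
* `K s t`: the inner iterations whose updates the value read is inconsistent with, and
  `keep s t t'` the diagonal `0`/`1` matrix attached to `t' ∈ K s t`, as a set of coordinates.

The read is determined by the past, the delay is at most `τ`, and, given the past, the pair
(mini-batch, coordinate set) is uniform on (`batches`) × (`Y`-element sets of coordinates). -/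
structure IsSchedule {Ω : Type*} [MeasurableSpace Ω] (P : Measure Ω) {N l b : ℕ}
    (Y τ S m : ℕ) (batches : Finset (Fin b → Fin l))
    (ℱ : Filtration ℕ (inferInstance : MeasurableSpace Ω))
    (batch : ℕ → ℕ → Ω → (Fin b → Fin l)) (coords : ℕ → ℕ → Ω → Finset (Fin N))
    (K : ℕ → ℕ → Ω → Finset ℕ) (keep : ℕ → ℕ → ℕ → Ω → Finset (Fin N)) : Prop where
  delay : ∀ s < S, ∀ t < m, ∀ ω, ∀ t' ∈ K s t ω, t' < t ∧ t - t' ≤ τ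
  K_adapted : ∀ s < S, ∀ t < m, ∀ A, MeasurableSet[ℱ (s * m + t)] {ω | K s t ω = A}
  keep_adapted : ∀ s < S, ∀ t < m, ∀ t' < t, ∀ A,
    MeasurableSet[ℱ (s * m + t)] {ω | keep s t t' ω = A}
  batch_adapted : ∀ s < S, ∀ t < m, ∀ B,
    MeasurableSet[ℱ (s * m + t + 1)] {ω | batch s t ω = B}
  coords_adapted : ∀ s < S, ∀ t < m, ∀ J,
    MeasurableSet[ℱ (s * m + t + 1)] {ω | coords s t ω = J}
  uniform : ∀ s < S, ∀ t < m, ∀ A, MeasurableSet[ℱ (s * m + t)] A →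
    ∀ B ∈ batches, ∀ J : Finset (Fin N), J.card = Y →
      P.real (A ∩ {ω | batch s t ω = B ∧ coords s t ω = J})
        = P.real A * (1 / (batches.card : ℝ)) * (1 / (N.choose Y : ℝ))

/-- The iterates of AsyDSZOVR along the random inputs above; `x s t`, `xh s t`, `v s t` stand for
`x_t^{s+1}`, the value read `x̂_t^{s+1}`, and `v̂_{J(t)}^{s+1}`.  Hence `x s 0` is `x^s`, which is
also the snapshot `x̃^s` of epoch `s`, and `x S 0` is the output `x^S`.  As `v s t` vanishes
outside `coords s t`, the update changes only the coordinates in that set. -/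
structure IsRun {Ω : Type*} {N l b : ℕ} (Y S m : ℕ) (γ : ℝ) (μ : Fin N → ℝ)
    (f : Fin l → EuclideanSpace ℝ (Fin N) → ℝ) (x0 : EuclideanSpace ℝ (Fin N))
    (batch : ℕ → ℕ → Ω → (Fin b → Fin l)) (coords : ℕ → ℕ → Ω → Finset (Fin N))
    (K : ℕ → ℕ → Ω → Finset ℕ) (keep : ℕ → ℕ → ℕ → Ω → Finset (Fin N))
    (x xh v : ℕ → ℕ → Ω → EuclideanSpace ℝ (Fin N)) : Prop where
  init : ∀ ω, x 0 0 ω = x0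
  epoch : ∀ s < S, ∀ ω, x (s + 1) 0 ω = x s m ω
  read : ∀ s < S, ∀ t < m, ∀ ω,
    x s t ω = xh s t ω - γ • ∑ t' ∈ K s t ω, mask (keep s t t' ω) (v s t' ω)
  compute : ∀ s < S, ∀ t < m, ∀ ω,
    v s t ω = direction Y μ f (batch s t ω) (coords s t ω) (xh s t ω) (x s 0 ω)
  update : ∀ s < S, ∀ t < m, ∀ ω, x s (t + 1) ω = x s t ω - γ • v s t ω

/-- `c N γ²/Y + L Y γ²/(2N) + γ³ N L² τ²/Y`. -/
def weight (N Y τ : ℕ) (L γ c : ℝ) : ℝ :=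
  c * N * γ ^ 2 / Y + L * Y * γ ^ 2 / (2 * N) + γ ^ 3 * N * L ^ 2 * (τ : ℝ) ^ 2 / Y

/-- `Y - 2 N L̃² γ² τ²`. -/
def gap (N Y τ : ℕ) (Lt γ : ℝ) : ℝ := Y - 2 * N * Lt ^ 2 * γ ^ 2 * (τ : ℝ) ^ 2

/-- The backward recursion for `c_t` with terminal value `c_m = 0`. -/
def IsCoeff (N Y τ b m : ℕ) (L Lt γ : ℝ) (β c : ℕ → ℝ) : Prop :=
  c m = 0 ∧ ∀ t < m, c t = c (t + 1) * (1 + γ * β t) +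
    weight N Y τ L γ (c (t + 1)) * (4 * Y * N * Lt ^ 2 / (b * gap N Y τ Lt γ))

/-- `Γ_t = γ/2 - (c_{t+1} N γ²/Y + L Y γ²/(2N) + γ³ N L² τ²/Y) 4 Y L̂/(Y - 2 N L̃² γ² τ²)`. -/
def Gam (N Y τ : ℕ) (L Lt Lh γ : ℝ) (c : ℕ → ℝ) (t : ℕ) : ℝ :=
  γ / 2 - weight N Y τ L γ (c (t + 1)) * (4 * Y * Lh / gap N Y τ Lt γ)

end AsyDSZOVR

end

namespace AsyDSZOVR

/-! Along `e_j` the smoothed function is a difference of primitives, so M = `mixedGrad` is exactly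
the vector of central difference quotients of f (`mixedGrad_eq`), and averaging the direction over
mini-batches and coordinate sets gives M(x̂) without bias (`sum_sum_direction`). In expectation the
descent lemma leaves -γ⟨∇f(x), M(x̂)⟩ + (L/2)γ²‖v‖² per step. Polarization turns the first term into
-(γ/2)‖∇f(x)‖² - (γ/2)‖M(x̂)‖² + (γ/2)‖∇f(x) - M(x̂)‖², and its last summand is at most γNω/4
(smoothing bias) plus γL̃²‖x - x̂‖² (delay).

The term -(γ/2)‖M(x̂)‖² absorbs the rest. On every path, ‖v‖ is controlled by ‖M(x̂)‖ and the
distance from x̂ to the snapshot. Since γm is at most a constant independent of l, b and m, a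
discrete Gronwall inequality over one epoch gives ∑‖v‖² ≤ C ∑‖M(x̂)‖² with C = `stepConst`. The
squared delays sum to at most γ²τ²∑‖v‖². For small u₀ both errors are dominated
(`epoch_path_bound`).

Hence the full coefficient γ/2 survives without a Lyapunov function. The c_t enter only through Γ:
nonnegativity of c_1 gives σb/(L̃l^α) ≤ Γ_0 ≤ γ/2, and an upper bound on c_t (`coeff_bound`) gives
Γ_t ≥ γ/4, whence σ₀ = u₀/4. -/

/-- The central difference quotient of `h` in the `j`-th coordinate. -/
noncomputable def centralDiff {N : ℕ} (μ : Fin N → ℝ) (h : EuclideanSpace ℝ (Fin N) → ℝ)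
    (x : EuclideanSpace ℝ (Fin N)) (j : Fin N) : ℝ :=
  (h (x + μ j • stdVec j) - h (x - μ j • stdVec j)) / (2 * μ j)

/-! ### Functions with Lipschitz gradient. -/

section Smooth

variable {E : Type*} [NormedAddCommGroup E] [InnerProductSpace ℝ E] [CompleteSpace E]
  {h : E → ℝ} {L : ℝ}

theorem hasDerivAt_comp_line (hd : Differentiable ℝ h) (x d : E) (t : ℝ) :
    HasDerivAt (fun s : ℝ => h (x + s • d)) (inner ℝ (gradient h (x + t • d)) d) t := by
  have h1 : HasDerivAt (fun s : ℝ => x + s • d) d t := by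
    simpa using ((hasDerivAt_id t).smul_const d).const_add x
  rw [inner_gradient_left]
  exact (hd (x + t • d)).hasFDerivAt.comp_hasDerivAt t h1

theorem abs_sub_sub_inner_gradient_le (hd : Differentiable ℝ h)
    (hL : ∀ x y, ‖gradient h x - gradient h y‖ ≤ L * ‖x - y‖) (x d : E) :
    |h (x + d) - h x - inner ℝ (gradient h x) d| ≤ L / 2 * ‖d‖ ^ 2 := by
  have key := image_norm_le_of_norm_deriv_right_le_deriv_boundary (a := (0 : ℝ)) (b := 1)
    (f := fun s : ℝ => h (x + s • d) - h x - s * inner ℝ (gradient h x) d)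
    (f' := fun s : ℝ => inner ℝ (gradient h (x + s • d)) d - inner ℝ (gradient h x) d)
    (B := fun s : ℝ => L / 2 * ‖d‖ ^ 2 * s ^ 2) (B' := fun s : ℝ => L * ‖d‖ ^ 2 * s)
    ?_ ?_ ?_ ?_ ?_ (Set.right_mem_Icc.2 zero_le_one)
  · simpa using key
  · intro s _
    refine (((hasDerivAt_comp_line hd x d s).continuousAt.sub continuousAt_const).sub
      ?_).continuousWithinAt
    fun_prop
  · intro s _
    have := ((hasDerivAt_comp_line hd x d s).sub_const (h x)).sub
      ((hasDerivAt_id s).mul_const (inner ℝ (gradient h x) d))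
    rw [one_mul] at this
    exact this.hasDerivWithinAt
  · simp
  · intro s
    have := ((hasDerivAt_id s).pow 2).const_mul (L / 2 * ‖d‖ ^ 2)
    refine this.congr_deriv ?_
    simp only [id, Nat.cast_ofNat, Nat.add_one_sub_one, pow_one, mul_one]
    ring
  · intro s hs
    rw [← inner_sub_left]
    refine (norm_inner_le_norm _ _).trans ?_
    have h1 := hL (x + s • d) x
    rw [add_sub_cancel_left, norm_smul, Real.norm_of_nonneg hs.1] at h1
    nlinarith [norm_nonneg d]

/-- Mean value inequality for z ↦ h z - h (z + d) with d = p - x, whose derivative has norm at most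
L‖d‖. The bound is a product of two distances, so after division by 2μ_j a central difference
quotient is Lipschitz with the constant L itself, whatever μ_j is. -/
theorem abs_sub_sub_sub_le (hd : Differentiable ℝ h)
    (hL : ∀ x y, ‖gradient h x - gradient h y‖ ≤ L * ‖x - y‖) (x y p q : E) (hpq : x - y = p - q) :
    |(h x - h y) - (h p - h q)| ≤ L * ‖x - p‖ * ‖x - y‖ := by
  set d := p - x with hdd
  have hg : Differentiable ℝ (fun z => h z - h (z + d)) :=
    hd.sub (hd.comp (differentiable_id.add_const d))
  have key := Convex.norm_image_sub_le_of_norm_fderiv_le (𝕜 := ℝ)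
    (f := fun z => h z - h (z + d)) (s := Set.univ) (C := L * ‖d‖)
    (fun z _ => hg z) ?_ convex_univ (Set.mem_univ y) (Set.mem_univ x)
  · have e1 : x + d = p := by simp [hdd]
    have e2 : y + d = q := by
      have : q = p - (x - y) := by rw [hpq]; abel
      rw [this, hdd]; abel
    rw [norm_sub_rev x p]
    simp only [e1, e2, Real.norm_eq_abs] at key
    convert key using 2
    ring
  · intro z _
    have e : fderiv ℝ (fun z => h z - h (z + d)) z = fderiv ℝ h z - fderiv ℝ h (z + d) := by
      rw [← fderiv_comp_add_right]
      exact fderiv_fun_sub (hd z) ((hd.comp (differentiable_id.add_const d)) z)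
    rw [e, ← toDual_gradient, ← toDual_gradient, ← map_sub, LinearIsometryEquiv.norm_map]
    refine (hL _ _).trans_eq ?_
    rw [sub_add_cancel_left, norm_neg]

end Smooth

/-! ### Central difference quotients and the mixtured gradient. -/

variable {N : ℕ} {μ : Fin N → ℝ} {h : EuclideanSpace ℝ (Fin N) → ℝ} {L : ℝ}

@[simp]
theorem norm_stdVec (j : Fin N) : ‖stdVec j‖ = 1 := by simp [stdVec]

theorem inner_stdVec (x : EuclideanSpace ℝ (Fin N)) (j : Fin N) :
    inner ℝ x (stdVec j) = x j := by
  simp [stdVec, EuclideanSpace.inner_single_right]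

theorem sum_smul_stdVec_apply (J : Finset (Fin N)) (a : Fin N → ℝ) (i : Fin N) :
    (∑ j ∈ J, a j • stdVec j : EuclideanSpace ℝ (Fin N)) i = if i ∈ J then a i else 0 := by
  simp [stdVec, Pi.single_apply]

theorem norm_sq_sum_smul_stdVec (a : Fin N → ℝ) :
    ‖(∑ j, a j • stdVec j : EuclideanSpace ℝ (Fin N))‖ ^ 2 = ∑ j, a j ^ 2 := by
  rw [EuclideanSpace.real_norm_sq_eq]
  simp [sum_smul_stdVec_apply]

theorem abs_le_norm_sum_smul_stdVec (a : Fin N → ℝ) (j : Fin N) :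
    |a j| ≤ ‖(∑ j, a j • stdVec j : EuclideanSpace ℝ (Fin N))‖ := by
  refine abs_le_of_sq_le_sq ?_ (norm_nonneg _)
  rw [norm_sq_sum_smul_stdVec]
  exact Finset.single_le_sum (f := fun j => a j ^ 2) (fun i _ => sq_nonneg _) (Finset.mem_univ j)

theorem norm_sum_smul_stdVec_le (J : Finset (Fin N)) (a : Fin N → ℝ) {C : ℝ} (hC : 0 ≤ C)
    (ha : ∀ j, |a j| ≤ C) :
    ‖(∑ j ∈ J, a j • stdVec j : EuclideanSpace ℝ (Fin N))‖ ≤ N * C := by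
  refine (norm_sum_le _ _).trans ?_
  calc ∑ j ∈ J, ‖a j • stdVec j‖ ≤ ∑ _j ∈ J, C := Finset.sum_le_sum fun j _ => by
        rw [norm_smul, norm_stdVec, mul_one]; exact ha j
    _ ≤ N * C := by
        rw [Finset.sum_const, nsmul_eq_mul]
        have : (J.card : ℝ) ≤ N := by exact_mod_cast card_finset_fin_le J
        gcongr

/-- Fundamental theorem of calculus: on the line through x in direction `e_j`, the smoothing is a
multiple of the difference of two shifts of one primitive of φ. -/
theorem lineDeriv_coordSmooth (hc : Continuous h) (x : EuclideanSpace ℝ (Fin N)) (j : Fin N) :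
    lineDeriv ℝ (coordSmooth μ h j) x (stdVec j) = centralDiff μ h x j := by
  set φ : ℝ → ℝ := fun v => h (x + v • stdVec j) with hφ
  have hφc : Continuous φ := by fun_prop
  have e : ∀ t : ℝ, coordSmooth μ h j (x + t • stdVec j)
      = 1 / (2 * μ j) * ((∫ v in (0 : ℝ)..(t + μ j), φ v) - ∫ v in (0 : ℝ)..(t + -μ j), φ v) := by
    intro t
    rw [intervalIntegral.integral_interval_sub_left (hφc.intervalIntegrable _ _)
      (hφc.intervalIntegrable _ _), ← intervalIntegral.integral_comp_add_left]
    simp only [coordSmooth, hφ, add_smul, add_assoc]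
  have hF : ∀ c : ℝ, HasDerivAt (fun t : ℝ => ∫ v in (0 : ℝ)..(t + c), φ v) (φ c) 0 := by
    intro c
    have h1 := intervalIntegral.integral_hasDerivAt_right (hφc.intervalIntegrable 0 (0 + c))
      hφc.aestronglyMeasurable.stronglyMeasurableAtFilter hφc.continuousAt
    have h2 := HasDerivAt.comp_add_const (0 : ℝ) c h1
    simpa using h2
  have h3 := (((hF (μ j)).sub (hF (-μ j))).const_mul (1 / (2 * μ j))).deriv
  rw [lineDeriv]
  simp only [e]
  refine h3.trans ?_
  simp only [hφ, centralDiff, neg_smul, ← sub_eq_add_neg]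
  ring

theorem mixedGrad_eq (hc : Continuous h) (x : EuclideanSpace ℝ (Fin N)) :
    mixedGrad μ h x = ∑ j, centralDiff μ h x j • stdVec j := by
  simp only [mixedGrad, lineDeriv_coordSmooth hc]

theorem G_eq (Y : ℕ) (J : Finset (Fin N)) (x : EuclideanSpace ℝ (Fin N)) :
    G Y μ J x h = ∑ j ∈ J, ((N : ℝ) / Y * centralDiff μ h x j) • stdVec j := by
  refine Finset.sum_congr rfl fun j _ => ?_
  congr 1
  rw [centralDiff]
  simp only [div_eq_mul_inv, mul_inv]
  ring

theorem abs_centralDiff_sub_le (hμ : ∀ j, 0 < μ j) (hd : Differentiable ℝ h)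
    (hL : ∀ x y, ‖gradient h x - gradient h y‖ ≤ L * ‖x - y‖)
    (x y : EuclideanSpace ℝ (Fin N)) (j : Fin N) :
    |centralDiff μ h x j - centralDiff μ h y j| ≤ L * ‖x - y‖ := by
  have key := abs_sub_sub_sub_le hd hL (x + μ j • stdVec j) (x - μ j • stdVec j)
    (y + μ j • stdVec j) (y - μ j • stdVec j) (by abel)
  have e1 : ‖x + μ j • stdVec j - (x - μ j • stdVec j)‖ = 2 * μ j := by
    have : x + μ j • stdVec j - (x - μ j • stdVec j) = (2 * μ j) • stdVec j := by
      rw [two_mul, add_smul]; abel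
    rw [this, norm_smul, norm_stdVec, Real.norm_of_nonneg (by linarith [hμ j]), mul_one]
  rw [e1, add_sub_add_right_eq_sub] at key
  have hp : 0 < 2 * μ j := by linarith [hμ j]
  rw [centralDiff, centralDiff, ← sub_div, abs_div, abs_of_pos hp, div_le_iff₀ hp]
  exact key

/-- The Taylor errors at the two endpoints are at most (L/2)μ_j² each; their sum is divided by 2μ_j.
-/
theorem abs_centralDiff_sub_gradient_le (hμ : ∀ j, 0 < μ j) (hd : Differentiable ℝ h)
    (hL : ∀ x y, ‖gradient h x - gradient h y‖ ≤ L * ‖x - y‖)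
    (x : EuclideanSpace ℝ (Fin N)) (j : Fin N) :
    |centralDiff μ h x j - gradient h x j| ≤ L / 2 * μ j := by
  have h1 := abs_sub_sub_inner_gradient_le hd hL x (μ j • stdVec j)
  have h2 := abs_sub_sub_inner_gradient_le hd hL x (-(μ j • stdVec j))
  rw [norm_neg, inner_neg_right] at h2
  rw [inner_smul_right, inner_stdVec, norm_smul, norm_stdVec, mul_one, Real.norm_eq_abs,
    sq_abs] at h1 h2
  have hp : 0 < 2 * μ j := by linarith [hμ j]
  have e : centralDiff μ h x j - gradient h x j
      = (h (x + μ j • stdVec j) - h (x - μ j • stdVec j) - gradient h x j * (2 * μ j))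
        / (2 * μ j) := by
    rw [centralDiff, sub_div _ (gradient h x j * (2 * μ j)), mul_div_cancel_right₀ _ hp.ne']
  rw [e, abs_div, abs_of_pos hp, div_le_iff₀ hp, sub_eq_add_neg x]
  rw [abs_le] at *
  constructor <;> nlinarith

theorem norm_sq_gradient_sub_mixedGrad_le (hμ : ∀ j, 0 < μ j) (hd : Differentiable ℝ h)
    (hL : ∀ x y, ‖gradient h x - gradient h y‖ ≤ L * ‖x - y‖) (x : EuclideanSpace ℝ (Fin N)) :
    ‖gradient h x - mixedGrad μ h x‖ ^ 2 ≤ N * smoothingBias L μ / 4 := by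
  have e : N * smoothingBias L μ / 4 = ∑ j, (L / 2 * μ j) ^ 2 := by
    simp only [mul_pow, ← Finset.mul_sum, smoothingBias]
    rcases Nat.eq_zero_or_pos N with rfl | hN
    · simp
    · have : (N : ℝ) ≠ 0 := by positivity
      field_simp
      ring
  rw [e, norm_sub_rev, EuclideanSpace.real_norm_sq_eq]
  refine Finset.sum_le_sum fun j _ => ?_
  rw [mixedGrad_eq hd.continuous, PiLp.sub_apply, sum_smul_stdVec_apply,
    if_pos (Finset.mem_univ j)]
  exact sq_le_sq' (abs_le.1 (abs_centralDiff_sub_gradient_le hμ hd hL x j)).1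
    (abs_le.1 (abs_centralDiff_sub_gradient_le hμ hd hL x j)).2

/-! ### The finite-sum objective. -/

section Average

variable {l : ℕ} {f : Fin l → EuclideanSpace ℝ (Fin N) → ℝ}

theorem differentiable_avg (hf : ∀ i, Differentiable ℝ (f i)) : Differentiable ℝ (avg f) := by
  unfold avg
  fun_prop

theorem gradient_avg (hf : ∀ i, Differentiable ℝ (f i)) (x : EuclideanSpace ℝ (Fin N)) :
    gradient (avg f) x = (1 / (l : ℝ)) • ∑ i, gradient (f i) x := by
  refine ext_inner_right ℝ fun y => ?_
  rw [inner_gradient_left, real_inner_smul_left, sum_inner]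
  simp only [inner_gradient_left]
  have h1 : HasFDerivAt (avg f) ((1 / (l : ℝ)) • ∑ i, fderiv ℝ (f i) x) x :=
    (HasFDerivAt.fun_sum fun i _ => (hf i x).hasFDerivAt).const_mul _
  rw [h1.fderiv]
  simp

theorem norm_gradient_avg_sub_le (hl : l ≠ 0) (hf : ∀ i, Differentiable ℝ (f i))
    (hL : ∀ i x y, ‖gradient (f i) x - gradient (f i) y‖ ≤ L * ‖x - y‖)
    (x y : EuclideanSpace ℝ (Fin N)) :
    ‖gradient (avg f) x - gradient (avg f) y‖ ≤ L * ‖x - y‖ := by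
  have hl' : (0 : ℝ) < l := by positivity
  rw [gradient_avg hf, gradient_avg hf, ← smul_sub, ← Finset.sum_sub_distrib, norm_smul,
    Real.norm_of_nonneg (by positivity)]
  calc 1 / (l : ℝ) * ‖∑ i, (gradient (f i) x - gradient (f i) y)‖
      ≤ 1 / (l : ℝ) * ∑ _i : Fin l, L * ‖x - y‖ := by
        gcongr
        exact norm_sum_le_of_le _ fun i _ => hL i x y
    _ = L * ‖x - y‖ := by
        rw [Finset.sum_const, Finset.card_univ, Fintype.card_fin, nsmul_eq_mul]
        field_simp

theorem centralDiff_avg (x : EuclideanSpace ℝ (Fin N)) (j : Fin N) :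
    centralDiff μ (avg f) x j = (1 / (l : ℝ)) * ∑ i, centralDiff μ (f i) x j := by
  simp only [centralDiff, avg, ← mul_sub, ← Finset.sum_sub_distrib, ← Finset.sum_div, mul_div_assoc]

end Average

/-- Adding r to all entries, cyclically modulo l, preserves both kinds of batch space; averaging
over r makes the k-th entry uniform. One argument thus covers sampling with and without replacement.
-/
theorem sum_sum_comp_apply_of_isBatchSpace {l b : ℕ} {M : Type*} [AddCommMonoid M]
    {batches : Finset (Fin b → Fin l)} (hB : IsBatchSpace batches) (φ : Fin l → M) (k : Fin b) :
    l • ∑ B ∈ batches, φ (B k) = batches.card • ∑ i, φ i := by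
  rcases Nat.eq_zero_or_pos l with rfl | hl
  · have : batches = ∅ := Finset.eq_empty_of_forall_notMem fun B _ => (B k).elim0
    simp [this]
  have : NeZero l := ⟨hl.ne'⟩
  have inv : ∀ r : Fin l, ∑ B ∈ batches, φ (B k) = ∑ B ∈ batches, φ (B k + r) := by
    intro r
    symm
    refine Finset.sum_equiv (Equiv.piCongrRight fun _ => Equiv.addRight r)
      (fun B => ?_) (fun B _ => rfl)
    rcases hB with h | h
    · exact iff_of_true (h _) (h _)
    · rw [h, h]
      exact ((Equiv.addRight r).injective.of_comp_iff B).symm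
  calc l • ∑ B ∈ batches, φ (B k) = ∑ _r : Fin l, ∑ B ∈ batches, φ (B k) := by
        rw [Finset.sum_const, Finset.card_univ, Fintype.card_fin]
    _ = ∑ B ∈ batches, ∑ r, φ (B k + r) := by
        rw [Finset.sum_congr rfl fun r _ => inv r, Finset.sum_comm]
    _ = batches.card • ∑ i, φ i := by
        rw [← Finset.sum_const]
        exact Finset.sum_congr rfl fun B _ => Equiv.sum_comp (Equiv.addLeft (B k)) φ

/-- Cyclic shifts permute the Y-element sets; averaging over them gives every coordinate the weight
Y/N, which the factor N/Y in `G` undoes. -/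
theorem sum_powersetCard_sum {N : ℕ} {M : Type*} [AddCommMonoid M] (Y : ℕ) (φ : Fin N → M) :
    N • ∑ J ∈ Finset.powersetCard Y (Finset.univ : Finset (Fin N)), ∑ j ∈ J, φ j
      = (N.choose Y * Y) • ∑ j, φ j := by
  rcases Nat.eq_zero_or_pos N with rfl | hN
  · simp
  have : NeZero N := ⟨hN.ne'⟩
  have inv : ∀ r : Fin N,
      ∑ J ∈ Finset.powersetCard Y (Finset.univ : Finset (Fin N)), ∑ j ∈ J, φ j
        = ∑ J ∈ Finset.powersetCard Y (Finset.univ : Finset (Fin N)), ∑ j ∈ J, φ (j + r) := by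
    intro r
    symm
    refine Finset.sum_equiv (Equiv.addRight r).finsetCongr (fun J => ?_) (fun J _ => ?_)
    · simp [Finset.mem_powersetCard]
    · simp [Finset.sum_map]
  calc N • ∑ J ∈ Finset.powersetCard Y (Finset.univ : Finset (Fin N)), ∑ j ∈ J, φ j
      = ∑ _r : Fin N, ∑ J ∈ Finset.powersetCard Y (Finset.univ : Finset (Fin N)),
          ∑ j ∈ J, φ j := by
        rw [Finset.sum_const, Finset.card_univ, Fintype.card_fin]
    _ = ∑ J ∈ Finset.powersetCard Y (Finset.univ : Finset (Fin N)), ∑ j ∈ J, ∑ r, φ (j + r) := by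
        rw [Finset.sum_congr rfl fun r _ => inv r, Finset.sum_comm]
        exact Finset.sum_congr rfl fun J _ => Finset.sum_comm
    _ = ∑ _J ∈ Finset.powersetCard Y (Finset.univ : Finset (Fin N)), Y • ∑ j, φ j := by
        refine Finset.sum_congr rfl fun J hJ => ?_
        rw [← (Finset.mem_powersetCard.1 hJ).2, ← Finset.sum_const]
        exact Finset.sum_congr rfl fun j _ => Equiv.sum_comp (Equiv.addLeft j) φ
    _ = (N.choose Y * Y) • ∑ j, φ j := by
        rw [Finset.sum_const, Finset.card_powersetCard, Finset.card_univ, Fintype.card_fin, mul_smul]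

theorem IsBatchSpace.nonempty {l b : ℕ} (hl : b ≤ l) {batches : Finset (Fin b → Fin l)}
    (hB : IsBatchSpace batches) : batches.Nonempty := by
  rcases hB with h | h
  · exact ⟨_, h (Fin.castLE hl)⟩
  · exact ⟨Fin.castLE hl, (h _).2 (Fin.castLE_injective hl)⟩

/-! ### Size and mean of the variance-reduced direction. -/

variable {N l b Y : ℕ} {μ : Fin N → ℝ} {f : Fin l → EuclideanSpace ℝ (Fin N) → ℝ} {L : ℝ}

/-- The variance-reduced difference quotient in the `j`-th coordinate. -/
noncomputable def reducedDiff (μ : Fin N → ℝ) (f : Fin l → EuclideanSpace ℝ (Fin N) → ℝ)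
    (B : Fin b → Fin l) (xh xt : EuclideanSpace ℝ (Fin N)) (j : Fin N) : ℝ :=
  (1 / (b : ℝ)) * ∑ k, (centralDiff μ (f (B k)) xh j - centralDiff μ (f (B k)) xt j)
    + centralDiff μ (avg f) xt j

theorem direction_eq (B : Fin b → Fin l) (J : Finset (Fin N)) (xh xt : EuclideanSpace ℝ (Fin N)) :
    direction Y μ f B J xh xt
      = ∑ j ∈ J, ((N : ℝ) / Y * reducedDiff μ f B xh xt j) • stdVec j := by
  ext i
  rw [sum_smul_stdVec_apply]
  simp only [direction, G_eq, PiLp.add_apply, PiLp.sub_apply, PiLp.smul_apply, smul_eq_mul,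
    WithLp.ofLp_sum, Finset.sum_apply, sum_smul_stdVec_apply, reducedDiff]
  have hs : ∀ y : EuclideanSpace ℝ (Fin N),
      ∑ k, (∑ j ∈ J, ((N : ℝ) / Y * centralDiff μ (f (B k)) y j) • stdVec j
        : EuclideanSpace ℝ (Fin N)) i
      = if i ∈ J then (N : ℝ) / Y * ∑ k, centralDiff μ (f (B k)) y i else 0 := by
    intro y
    simp only [sum_smul_stdVec_apply]
    split_ifs
    · rw [Finset.mul_sum]
    · simp
  split_ifs with hi
  · simp [hi, stdVec, Finset.sum_sub_distrib, ← Finset.mul_sum]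
    ring
  · simp [hi, stdVec]

/-- The batch differences cost L‖xh - xt‖, and moving the full quotient from xt to xh costs the same
again. This holds for every batch, so no variance estimate is needed later. -/
theorem abs_reducedDiff_le (hb : b ≠ 0) (hl : l ≠ 0) (hμ : ∀ j, 0 < μ j)
    (hf : ∀ i, Differentiable ℝ (f i))
    (hL : ∀ i x y, ‖gradient (f i) x - gradient (f i) y‖ ≤ L * ‖x - y‖)
    (B : Fin b → Fin l) (xh xt : EuclideanSpace ℝ (Fin N)) (j : Fin N) :
    |reducedDiff μ f B xh xt j| ≤ 2 * L * ‖xh - xt‖ + ‖mixedGrad μ (avg f) xh‖ := by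
  have hb' : (0 : ℝ) < b := by positivity
  have h1 : |(1 / (b : ℝ)) * ∑ k, (centralDiff μ (f (B k)) xh j - centralDiff μ (f (B k)) xt j)|
      ≤ L * ‖xh - xt‖ := by
    rw [abs_mul, abs_of_pos (by positivity : (0 : ℝ) < 1 / b)]
    calc _ ≤ 1 / (b : ℝ) * ∑ _k : Fin b, L * ‖xh - xt‖ := by
          gcongr
          exact (Finset.abs_sum_le_sum_abs _ _).trans
            (Finset.sum_le_sum fun k _ => abs_centralDiff_sub_le hμ (hf _) (hL _) xh xt j)
      _ = L * ‖xh - xt‖ := by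
          rw [Finset.sum_const, Finset.card_univ, Fintype.card_fin, nsmul_eq_mul]
          field_simp
  have h2 := abs_centralDiff_sub_le hμ (differentiable_avg hf)
    (norm_gradient_avg_sub_le hl hf hL) xt xh j
  rw [norm_sub_rev] at h2
  have h3 := abs_le_norm_sum_smul_stdVec (centralDiff μ (avg f) xh) j
  rw [← mixedGrad_eq (differentiable_avg hf).continuous] at h3
  rw [reducedDiff]
  rw [abs_le] at *
  constructor <;> linarith

theorem norm_direction_le (hb : b ≠ 0) (hl : l ≠ 0) (hY : 1 ≤ Y) (hμ : ∀ j, 0 < μ j)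
    (hf : ∀ i, Differentiable ℝ (f i)) (hL0 : 0 ≤ L)
    (hL : ∀ i x y, ‖gradient (f i) x - gradient (f i) y‖ ≤ L * ‖x - y‖)
    (B : Fin b → Fin l) (J : Finset (Fin N)) (xh xt : EuclideanSpace ℝ (Fin N)) :
    ‖direction Y μ f B J xh xt‖
      ≤ (N : ℝ) ^ 2 * (2 * L * ‖xh - xt‖ + ‖mixedGrad μ (avg f) xh‖) := by
  rw [direction_eq, pow_two, mul_assoc]
  refine norm_sum_smul_stdVec_le J _ (by positivity) fun j => ?_
  rw [abs_mul, abs_of_nonneg (by positivity)]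
  have hY' : (1 : ℝ) ≤ Y := by exact_mod_cast hY
  gcongr
  · exact div_le_self (by positivity) hY'
  · exact abs_reducedDiff_le hb hl hμ hf hL B xh xt j

theorem sum_reducedDiff (hb : b ≠ 0) (hl : l ≠ 0) {batches : Finset (Fin b → Fin l)}
    (hB : IsBatchSpace batches) (xh xt : EuclideanSpace ℝ (Fin N)) (j : Fin N) :
    ∑ B ∈ batches, reducedDiff μ f B xh xt j
      = (batches.card : ℝ) * centralDiff μ (avg f) xh j := by
  have hb' : (b : ℝ) ≠ 0 := by positivity
  have hl' : (l : ℝ) ≠ 0 := by positivity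
  have h1 : ∀ k : Fin b,
      ∑ B ∈ batches, (centralDiff μ (f (B k)) xh j - centralDiff μ (f (B k)) xt j)
        = (batches.card : ℝ) * (centralDiff μ (avg f) xh j - centralDiff μ (avg f) xt j) := by
    intro k
    have := sum_sum_comp_apply_of_isBatchSpace hB
      (fun i => centralDiff μ (f i) xh j - centralDiff μ (f i) xt j) k
    rw [nsmul_eq_mul, nsmul_eq_mul, mul_comm, ← eq_div_iff hl'] at this
    rw [this, centralDiff_avg, centralDiff_avg, Finset.sum_sub_distrib]
    field_simp
  simp only [reducedDiff]
  rw [Finset.sum_add_distrib, ← Finset.mul_sum, Finset.sum_comm, Finset.sum_congr rfl fun k _ => h1 k,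
    Finset.sum_const, Finset.sum_const, Finset.card_univ, Fintype.card_fin]
  simp only [nsmul_eq_mul]
  field_simp
  ring

/-- The direction is an unbiased estimate of the mixtured gradient at the value read. -/
theorem sum_sum_direction (hb : b ≠ 0) (hl : l ≠ 0) (hY : 1 ≤ Y) (hYN : Y ≤ N)
    (hf : ∀ i, Differentiable ℝ (f i)) {batches : Finset (Fin b → Fin l)}
    (hB : IsBatchSpace batches) (xh xt : EuclideanSpace ℝ (Fin N)) :
    ∑ B ∈ batches, ∑ J ∈ Finset.powersetCard Y Finset.univ, direction Y μ f B J xh xt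
      = ((batches.card : ℝ) * (N.choose Y : ℝ)) • mixedGrad μ (avg f) xh := by
  have hY' : (Y : ℝ) ≠ 0 := by positivity
  have hN' : (N : ℝ) ≠ 0 := by
    have : N ≠ 0 := by omega
    positivity
  have h1 : ∀ B : Fin b → Fin l,
      ∑ J ∈ Finset.powersetCard Y Finset.univ, direction Y μ f B J xh xt
        = (N.choose Y : ℝ) • ∑ j, reducedDiff μ f B xh xt j • stdVec j := by
    intro B
    have := sum_powersetCard_sum Y (fun j => (reducedDiff μ f B xh xt j • stdVec j
      : EuclideanSpace ℝ (Fin N)))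
    rw [← Nat.cast_smul_eq_nsmul ℝ, ← Nat.cast_smul_eq_nsmul ℝ] at this
    simp only [direction_eq, mul_smul]
    simp only [← Finset.smul_sum]
    rw [div_eq_mul_inv, mul_comm, mul_smul, this, smul_smul]
    congr 1
    push_cast
    field_simp
  rw [Finset.sum_congr rfl fun B _ => h1 B, ← Finset.smul_sum, Finset.sum_comm]
  simp only [← Finset.sum_smul, sum_reducedDiff hb hl hB]
  rw [mixedGrad_eq (differentiable_avg hf).continuous]
  simp only [mul_smul, ← Finset.smul_sum]
  rw [smul_comm]

/-! ### Gronwall, delay windows and a backward recursion. -/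

section Sequences

theorem sum_range_le_pow_mul_sum {m : ℕ} {k : ℝ} (hk : 0 ≤ k) {V M : ℕ → ℝ} (hM : ∀ t, 0 ≤ M t)
    (h : ∀ t < m, V t ≤ k * ∑ i ∈ Finset.range t, V i + M t) :
    ∀ t ≤ m, ∑ i ∈ Finset.range t, V i ≤ (1 + k) ^ t * ∑ i ∈ Finset.range t, M i := by
  intro t
  induction t with
  | zero => simp
  | succ t ih =>
    intro ht
    have h1 := ih (by omega)
    have h2 := h t (by omega)
    rw [Finset.sum_range_succ, Finset.sum_range_succ]
    have h3 : (1 : ℝ) ≤ (1 + k) ^ (t + 1) := one_le_pow₀ (by linarith)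
    have h4 := hM t
    have h5 : (1 + k) * ∑ i ∈ Finset.range t, V i
        ≤ (1 + k) * ((1 + k) ^ t * ∑ i ∈ Finset.range t, M i) := by gcongr
    have h6 : M t ≤ (1 + k) ^ (t + 1) * M t := le_mul_of_one_le_left h4 h3
    rw [pow_succ] at *
    nlinarith

/-- A discrete Gronwall inequality in quadratic mean. -/
theorem sum_sq_le_of_le_mul_sum_add {m : ℕ} {k R : ℝ} (hk : 0 ≤ k) (hR : k * m ≤ R)
    {V M : ℕ → ℝ} (hV : ∀ t, 0 ≤ V t) (hM : ∀ t, 0 ≤ M t)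
    (h : ∀ t < m, V t ≤ k * ∑ i ∈ Finset.range t, V i + M t) :
    ∑ t ∈ Finset.range m, V t ^ 2
      ≤ (2 * (R * Real.exp R) ^ 2 + 2) * ∑ t ∈ Finset.range m, M t ^ 2 := by
  set S := ∑ t ∈ Finset.range m, M t with hS
  have hS0 : 0 ≤ S := Finset.sum_nonneg fun t _ => hM t
  have hR0 : 0 ≤ R := le_trans (by positivity) hR
  -- The factor m lost to Cauchy–Schwarz here and the m from summing over t combine with k² into (k
  -- m)² ≤ R², so the final constant does not depend on m.
  have hS2 : S ^ 2 ≤ m * ∑ t ∈ Finset.range m, M t ^ 2 := by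
    simpa using sq_sum_le_card_mul_sum_sq (s := Finset.range m) (f := M)
  have hexp : ∀ t ≤ m, (1 + k) ^ t ≤ Real.exp R := by
    intro t ht
    calc (1 + k) ^ t ≤ Real.exp k ^ t := by
          gcongr
          linarith [Real.add_one_le_exp k]
      _ = Real.exp (k * t) := by rw [mul_comm, Real.exp_nat_mul]
      _ ≤ Real.exp R := by
          gcongr
          refine le_trans ?_ hR
          gcongr
  have hb : ∀ t < m, V t ≤ k * (Real.exp R * S) + M t := by
    intro t ht
    refine (h t ht).trans ?_
    gcongr
    refine (sum_range_le_pow_mul_sum hk hM h t ht.le).trans ?_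
    have : ∑ i ∈ Finset.range t, M i ≤ S :=
      Finset.sum_le_sum_of_subset_of_nonneg (Finset.range_subset_range.2 ht.le) fun i _ _ => hM i
    gcongr
    · exact Finset.sum_nonneg fun i _ => hM i
    · exact hexp t ht.le
  calc ∑ t ∈ Finset.range m, V t ^ 2
      ≤ ∑ t ∈ Finset.range m, (2 * (k * (Real.exp R * S)) ^ 2 + 2 * M t ^ 2) := by
        refine Finset.sum_le_sum fun t ht => ?_
        have h1 := hb t (Finset.mem_range.1 ht)
        have h2 : V t ^ 2 ≤ (k * (Real.exp R * S) + M t) ^ 2 := by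
          have := hV t
          gcongr
        nlinarith [sq_nonneg (k * (Real.exp R * S) - M t)]
    _ = 2 * k ^ 2 * Real.exp R ^ 2 * (m * S ^ 2) + 2 * ∑ t ∈ Finset.range m, M t ^ 2 := by
        rw [Finset.sum_add_distrib, Finset.sum_const, Finset.card_range, nsmul_eq_mul,
          ← Finset.mul_sum]
        ring
    _ ≤ 2 * k ^ 2 * Real.exp R ^ 2 * (m * (m * ∑ t ∈ Finset.range m, M t ^ 2))
          + 2 * ∑ t ∈ Finset.range m, M t ^ 2 := by gcongr
    _ = (2 * ((k * m) * Real.exp R) ^ 2 + 2) * ∑ t ∈ Finset.range m, M t ^ 2 := by ring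
    _ ≤ _ := by gcongr

/-- One factor τ comes from Cauchy–Schwarz on a window of at most τ indices, the other from each
index lying in at most τ windows. -/
theorem sum_range_sq_sum_Ico_le (m τ : ℕ) (V : ℕ → ℝ) :
    ∑ t ∈ Finset.range m, (∑ i ∈ Finset.Ico (t - τ) t, V i) ^ 2
      ≤ (τ : ℝ) ^ 2 * ∑ t ∈ Finset.range m, V t ^ 2 := by
  have h1 : ∀ t, (∑ i ∈ Finset.Ico (t - τ) t, V i) ^ 2
      ≤ τ * ∑ i ∈ Finset.Ico (t - τ) t, V i ^ 2 := by
    intro t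
    refine sq_sum_le_card_mul_sum_sq.trans ?_
    gcongr
    rw [Nat.card_Ico]
    omega
  have h2 : ∀ t ∈ Finset.range m, ∑ i ∈ Finset.Ico (t - τ) t, V i ^ 2
      = ∑ i ∈ Finset.range m, if i ∈ Finset.Ico (t - τ) t then V i ^ 2 else 0 := by
    intro t ht
    rw [← Finset.sum_filter]
    refine Finset.sum_congr ?_ fun _ _ => rfl
    ext i
    simp only [Finset.mem_filter, Finset.mem_range, Finset.mem_Ico] at *
    omega
  calc _ ≤ ∑ t ∈ Finset.range m, τ * ∑ i ∈ Finset.Ico (t - τ) t, V i ^ 2 :=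
        Finset.sum_le_sum fun t _ => h1 t
    _ = τ * ∑ i ∈ Finset.range m, ∑ t ∈ Finset.range m,
          if i ∈ Finset.Ico (t - τ) t then V i ^ 2 else 0 := by
        rw [← Finset.mul_sum, Finset.sum_congr rfl h2, Finset.sum_comm]
    _ ≤ τ * ∑ i ∈ Finset.range m, τ * V i ^ 2 := by
        gcongr with i hi
        rw [← Finset.sum_filter, Finset.sum_const, nsmul_eq_mul]
        gcongr
        have : ({t ∈ Finset.range m | i ∈ Finset.Ico (t - τ) t}) ⊆ Finset.Ioc i (i + τ) := by
          intro t ht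
          simp only [Finset.mem_filter, Finset.mem_range, Finset.mem_Ico, Finset.mem_Ioc] at *
          omega
        simpa using Finset.card_le_card this
    _ = _ := by rw [← Finset.mul_sum]; ring

/-- A backward linear recursion stays bounded as long as the accumulated growth does. -/
theorem backward_recursion_bound {m : ℕ} {θ κ : ℝ} (hθ : 0 ≤ θ) (hκ : 0 ≤ κ) (hm : m * θ ≤ 1 / 2)
    {c : ℕ → ℝ} (h0 : c m = 0) (hc : ∀ t < m, c t = c (t + 1) * (1 + θ) + κ) :
    ∀ t ≤ m, 0 ≤ c t ∧ c t ≤ 2 * κ * (m - t : ℕ) := by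
  intro t ht
  induction ht using Nat.decreasingInduction with
  | self => simp [h0]
  | of_succ t ht ih =>
    obtain ⟨i1, i2⟩ := ih
    have e : ((m - t : ℕ) : ℝ) = (m - (t + 1) : ℕ) + 1 := by
      have : m - t = m - (t + 1) + 1 := by omega
      rw [this]; push_cast; ring
    have hle : ((m - (t + 1) : ℕ) : ℝ) ≤ m := by exact_mod_cast Nat.sub_le _ _
    rw [hc t ht, e]
    set r : ℝ := ((m - (t + 1) : ℕ) : ℝ)
    refine ⟨by positivity, ?_⟩
    -- One more step back adds 2κrθ + κ, which is at most 2κ because rθ ≤ 1/2.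
    have h1 : r * θ ≤ 1 / 2 := le_trans (by gcongr) hm
    have h2 : c (t + 1) * (1 + θ) ≤ 2 * κ * r * (1 + θ) := by gcongr
    nlinarith

end Sequences

/-! ### The coefficients c_t and Γ_t. -/

section Coefficients

variable {N Y τ b m : ℕ} {L Lt Lh γ : ℝ} {β c : ℕ → ℝ}

theorem weight_nonneg (hL : 0 ≤ L) (hγ : 0 ≤ γ) {r : ℝ} (hr : 0 ≤ r) :
    0 ≤ weight N Y τ L γ r := by
  unfold weight
  positivity

theorem half_le_gap (hY : 1 ≤ Y) (hLt : 0 < Lt) (hγ : 0 ≤ γ) {u : ℝ} (hu1 : u ≤ 1)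
    (hγu : Lt * γ ≤ u) (hu : u * (4 * N * (τ : ℝ) ^ 2) ≤ 1) :
    (Y : ℝ) / 2 ≤ gap N Y τ Lt γ := by
  have hY' : (1 : ℝ) ≤ Y := by exact_mod_cast hY
  have h0 : 0 ≤ Lt * γ := by positivity
  have h1 : (Lt * γ) ^ 2 ≤ u := by nlinarith
  have h2 : (Lt * γ) ^ 2 * (4 * N * (τ : ℝ) ^ 2) ≤ 1 :=
    le_trans (by gcongr) hu
  unfold gap
  nlinarith

/-- The inhomogeneous term of the recursion has order γ² and there are m steps with γm bounded; the
remaining factor L̃γ is at most 1, so the bound is free of l, b and m. -/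
theorem coeff_bound (hY : 1 ≤ Y) (hYN : Y ≤ N) (hL : 0 ≤ L) (hLt : 0 < Lt) (hb : 1 ≤ b)
    (hγ : 0 ≤ γ) {u : ℝ} (hu1 : u ≤ 3 / 16) (hγu : Lt * γ ≤ u)
    (hu : u * (4 * N * (τ : ℝ) ^ 2) ≤ 1) (hm : γ * m ≤ Y / (5 * Lt * (N : ℝ) ^ 2))
    (hβ : ∀ t, β t = Lt * (N : ℝ) ^ 2 / Y) (hc : IsCoeff N Y τ b m L Lt γ β c) :
    ∀ t ≤ m, 0 ≤ c t ∧ c t ≤ 4 * (L + N * L ^ 2 * (τ : ℝ) ^ 2 / Lt) := by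
  have hY' : (1 : ℝ) ≤ Y := by exact_mod_cast hY
  have hYN' : (Y : ℝ) ≤ N := by exact_mod_cast hYN
  have hN' : (1 : ℝ) ≤ N := hY'.trans hYN'
  have hb' : (1 : ℝ) ≤ b := by exact_mod_cast hb
  have hgap := half_le_gap (N := N) (τ := τ) hY hLt hγ (hu1.trans (by norm_num)) hγu hu
  have hgap0 : 0 < gap N Y τ Lt γ := lt_of_lt_of_le (by positivity) hgap
  have hu0 : 0 ≤ u := le_trans (by positivity) hγu
  set D := 4 * Y * N * Lt ^ 2 / (b * gap N Y τ Lt γ) with hD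
  have hD0 : 0 ≤ D := by positivity
  have hD8 : D ≤ 8 * N * Lt ^ 2 := by
    rw [hD, div_le_iff₀ (by positivity)]
    have : (Y : ℝ) / 2 ≤ b * gap N Y τ Lt γ :=
      hgap.trans (le_mul_of_one_le_left hgap0.le hb')
    calc 4 * Y * N * Lt ^ 2 = 8 * N * Lt ^ 2 * (Y / 2) := by ring
      _ ≤ _ := by gcongr
  set a := L * Y * γ ^ 2 / (2 * N) + γ ^ 3 * N * L ^ 2 * (τ : ℝ) ^ 2 / Y with ha
  have ha0 : 0 ≤ a := by positivity
  have hmγ : γ * m * (5 * Lt * (N : ℝ) ^ 2) ≤ Y := by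
    rwa [le_div_iff₀ (by positivity)] at hm
  obtain ⟨hcm, hrec⟩ := hc
  -- The part of the weight proportional to c joins the growth rate θ; the rest, a, yields κ. The
  -- value 3/16 is fitted to mθ ≤ 1/5 + 3/10 = 1/2.
  have key := backward_recursion_bound (m := m) (c := c)
    (θ := γ * (Lt * (N : ℝ) ^ 2 / Y) + N * γ ^ 2 / Y * D) (κ := a * D)
    (by positivity) (by positivity) ?_ hcm ?_
  · intro t ht
    refine ⟨(key t ht).1, (key t ht).2.trans ?_⟩
    have h1 : ((m - t : ℕ) : ℝ) ≤ m := by exact_mod_cast Nat.sub_le _ _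
    have h2 : a ≤ γ ^ 2 * (L + N * L ^ 2 * (τ : ℝ) ^ 2 / Lt) := by
      have e1 : L * Y * γ ^ 2 / (2 * N) ≤ γ ^ 2 * L := by
        rw [div_le_iff₀ (by positivity)]
        have : L * γ ^ 2 * Y ≤ L * γ ^ 2 * N := by gcongr
        have : 0 ≤ L * γ ^ 2 * N := by positivity
        nlinarith
      have e2 : γ ^ 3 * N * L ^ 2 * (τ : ℝ) ^ 2 / Y ≤ γ ^ 2 * (N * L ^ 2 * (τ : ℝ) ^ 2 / Lt) := by
        have hg : γ ≤ 1 / Lt := by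
          rw [le_div_iff₀ hLt]
          nlinarith
        calc γ ^ 3 * N * L ^ 2 * (τ : ℝ) ^ 2 / Y ≤ γ ^ 3 * N * L ^ 2 * (τ : ℝ) ^ 2 :=
              div_le_self (by positivity) hY'
          _ = γ ^ 2 * (N * L ^ 2 * (τ : ℝ) ^ 2) * γ := by ring
          _ ≤ γ ^ 2 * (N * L ^ 2 * (τ : ℝ) ^ 2) * (1 / Lt) := by gcongr
          _ = _ := by ring
      rw [ha]
      linarith
    set Q := L + N * L ^ 2 * (τ : ℝ) ^ 2 / Lt
    have hQ : 0 ≤ Q := by positivity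
    calc 2 * (a * D) * ((m - t : ℕ) : ℝ) ≤ 2 * (γ ^ 2 * Q * (8 * N * Lt ^ 2)) * m := by gcongr
      _ = 16 / 5 * (γ * m * (5 * Lt * (N : ℝ) ^ 2)) * (Lt * γ) * Q / N := by
          field_simp
          ring
      _ ≤ 16 / 5 * N * 1 * Q / N := by
          gcongr
          · exact hmγ.trans hYN'
          · linarith
      _ = 16 / 5 * Q := by field_simp
      _ ≤ 4 * Q := by gcongr; norm_num
  · have h1 : (m : ℝ) * (γ * (Lt * (N : ℝ) ^ 2 / Y)) ≤ 1 / 5 := by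
      have : (m : ℝ) * (γ * (Lt * (N : ℝ) ^ 2 / Y)) = γ * m * (5 * Lt * (N : ℝ) ^ 2) / (5 * Y) := by
        field_simp
      rw [this, div_le_iff₀ (by positivity)]
      linarith
    have h2 : (m : ℝ) * (N * γ ^ 2 / Y * D) ≤ 3 / 10 := by
      calc (m : ℝ) * (N * γ ^ 2 / Y * D) ≤ m * (N * γ ^ 2 / Y * (8 * N * Lt ^ 2)) := by gcongr
        _ = 8 / 5 * (γ * m * (5 * Lt * (N : ℝ) ^ 2)) * (Lt * γ) / Y := by
            field_simp
        _ ≤ 8 / 5 * Y * (3 / 16) / Y := by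
            gcongr
            linarith
        _ = 3 / 10 := by field_simp; norm_num
    linarith
  · intro t ht
    rw [hrec t ht, hβ, weight, ha]
    ring

/-- The subtracted term of Γ_t has order γ², so a small L̃γ pushes it below γ/4; `hu'` is that
smallness condition. -/
theorem quarter_le_Gam (hY : 1 ≤ Y) (hYN : Y ≤ N) (hL : 0 ≤ L) (hLt : 0 < Lt) (hLh : 0 ≤ Lh)
    (hb : 1 ≤ b) (hγ : 0 ≤ γ) {u : ℝ} (hu1 : u ≤ 3 / 16) (hγu : Lt * γ ≤ u)
    (hu : u * (4 * N * (τ : ℝ) ^ 2) ≤ 1)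
    (hu' : u * (32 * Lh * (5 * N * (L + N * L ^ 2 * (τ : ℝ) ^ 2 / Lt)) / Lt) ≤ 1)
    (hm : γ * m ≤ Y / (5 * Lt * (N : ℝ) ^ 2))
    (hβ : ∀ t, β t = Lt * (N : ℝ) ^ 2 / Y) (hc : IsCoeff N Y τ b m L Lt γ β c)
    {t : ℕ} (ht : t < m) : γ / 4 ≤ Gam N Y τ L Lt Lh γ c t := by
  have hY' : (1 : ℝ) ≤ Y := by exact_mod_cast hY
  have hYN' : (Y : ℝ) ≤ N := by exact_mod_cast hYN
  have hN' : (1 : ℝ) ≤ N := hY'.trans hYN'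
  have hgap := half_le_gap (N := N) (τ := τ) hY hLt hγ (hu1.trans (by norm_num)) hγu hu
  have hgap0 : 0 < gap N Y τ Lt γ := lt_of_lt_of_le (by positivity) hgap
  have hu0 : 0 ≤ u := le_trans (by positivity) hγu
  obtain ⟨hc0, hc1⟩ := coeff_bound hY hYN hL hLt hb hγ hu1 hγu hu hm hβ hc (t + 1) ht
  set Q := L + N * L ^ 2 * (τ : ℝ) ^ 2 / Lt with hQdef
  have hQ : 0 ≤ Q := by positivity
  have hg : γ ≤ 1 / Lt := by
    rw [le_div_iff₀ hLt]
    nlinarith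
  have hw : weight N Y τ L γ (c (t + 1)) ≤ γ ^ 2 * (5 * N * Q) := by
    have e1 : c (t + 1) * N * γ ^ 2 / Y ≤ γ ^ 2 * (4 * N * Q) := by
      calc c (t + 1) * N * γ ^ 2 / Y ≤ c (t + 1) * N * γ ^ 2 := div_le_self (by positivity) hY'
        _ ≤ 4 * Q * N * γ ^ 2 := by gcongr
        _ = _ := by ring
    have e2 : L * Y * γ ^ 2 / (2 * N) ≤ γ ^ 2 * (N * L) := by
      rw [div_le_iff₀ (by positivity)]
      calc L * Y * γ ^ 2 ≤ L * N * γ ^ 2 := by gcongr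
        _ ≤ L * N * γ ^ 2 * (2 * N) := le_mul_of_one_le_right (by positivity) (by linarith)
        _ = _ := by ring
    have e3 : γ ^ 3 * N * L ^ 2 * (τ : ℝ) ^ 2 / Y
        ≤ γ ^ 2 * (N * (N * L ^ 2 * (τ : ℝ) ^ 2 / Lt)) := by
      calc γ ^ 3 * N * L ^ 2 * (τ : ℝ) ^ 2 / Y ≤ γ ^ 3 * N * L ^ 2 * (τ : ℝ) ^ 2 :=
            div_le_self (by positivity) hY'
        _ = γ ^ 2 * (1 * (N * L ^ 2 * (τ : ℝ) ^ 2)) * γ := by ring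
        _ ≤ γ ^ 2 * (N * (N * L ^ 2 * (τ : ℝ) ^ 2)) * (1 / Lt) := by gcongr
        _ = _ := by ring
    -- 5 = 4 + 1: four parts from the bound on c, one from the two remaining terms of the weight.
    have e4 : γ ^ 2 * (5 * N * Q) = γ ^ 2 * (4 * N * Q) + γ ^ 2 * (N * L)
        + γ ^ 2 * (N * (N * L ^ 2 * (τ : ℝ) ^ 2 / Lt)) := by rw [hQdef]; ring
    rw [weight, e4]
    linarith
  have hw0 := weight_nonneg (N := N) (Y := Y) (τ := τ) hL hγ hc0
  have hdiv : 4 * Y * Lh / gap N Y τ Lt γ ≤ 8 * Lh := by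
    rw [div_le_iff₀ hgap0]
    calc 4 * Y * Lh = 8 * Lh * (Y / 2) := by ring
      _ ≤ _ := by gcongr
  have hprod : weight N Y τ L γ (c (t + 1)) * (4 * Y * Lh / gap N Y τ Lt γ) ≤ γ / 4 := by
    calc weight N Y τ L γ (c (t + 1)) * (4 * Y * Lh / gap N Y τ Lt γ)
        ≤ γ ^ 2 * (5 * N * Q) * (8 * Lh) := by gcongr
      _ = γ / 4 * ((Lt * γ) * (32 * Lh * (5 * N * Q) / Lt)) := by
          field_simp
          ring
      _ ≤ γ / 4 * (u * (32 * Lh * (5 * N * Q) / Lt)) := by gcongr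
      _ ≤ γ / 4 * 1 := by gcongr
      _ = γ / 4 := mul_one _
  rw [Gam]
  linarith

theorem Gam_le_half (hL : 0 ≤ L) (hLh : 0 ≤ Lh) (hγ : 0 ≤ γ) (hgap : 0 < gap N Y τ Lt γ) {t : ℕ}
    (hc : 0 ≤ c (t + 1)) : Gam N Y τ L Lt Lh γ c t ≤ γ / 2 := by
  have := weight_nonneg (N := N) (Y := Y) (τ := τ) hL hγ hc
  exact sub_le_self _ (by positivity)

end Coefficients

/-! ### Random variables with finitely many values. -/

/-- `g` takes finitely many values, each on an event of `𝓐`. -/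
def FinitelyValued {Ω β : Type*} (𝓐 : MeasurableSpace Ω) (g : Ω → β) : Prop :=
  (Set.range g).Finite ∧ ∀ y, MeasurableSet[𝓐] {ω | g ω = y}

namespace FinitelyValued

variable {Ω β δ ε : Type*} {𝓐 𝓑 : MeasurableSpace Ω} {g : Ω → β} {h : Ω → δ}

theorem const (y : β) : FinitelyValued 𝓐 (fun _ : Ω => y) :=
  ⟨Set.finite_range_const, fun z => MeasurableSet.const (y = z)⟩

theorem mono (hg : FinitelyValued 𝓐 g) (hle : 𝓐 ≤ 𝓑) : FinitelyValued 𝓑 g :=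
  ⟨hg.1, fun y => hle _ (hg.2 y)⟩

/-- F is arbitrary, since each event is a finite union of level sets. Gradients and difference
quotients of iterates therefore need no measurability argument, and real-valued ones are integrable.
-/
theorem comp (hg : FinitelyValued 𝓐 g) (F : β → δ) : FinitelyValued 𝓐 (fun ω => F (g ω)) := by
  refine ⟨?_, fun z => ?_⟩
  · rw [show (fun ω => F (g ω)) = F ∘ g from rfl, Set.range_comp]
    exact hg.1.image F
  · have e : {ω | F (g ω) = z} = ⋃ y ∈ Set.range g ∩ {y | F y = z}, {ω | g ω = y} := by
      ext ω
      simp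
    rw [e]
    exact (hg.1.subset Set.inter_subset_left).measurableSet_biUnion fun y _ => hg.2 y

theorem prodMk (hg : FinitelyValued 𝓐 g) (hh : FinitelyValued 𝓐 h) :
    FinitelyValued 𝓐 (fun ω => (g ω, h ω)) := by
  refine ⟨(hg.1.prod hh.1).subset ?_, fun z => ?_⟩
  · rintro _ ⟨ω, rfl⟩
    exact ⟨⟨ω, rfl⟩, ⟨ω, rfl⟩⟩
  · have e : {ω | (g ω, h ω) = z} = {ω | g ω = z.1} ∩ {ω | h ω = z.2} := by
      ext ω
      simp [Prod.ext_iff]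
    rw [e]
    exact (hg.2 _).inter (hh.2 _)

theorem map₂ (hg : FinitelyValued 𝓐 g) (hh : FinitelyValued 𝓐 h) (F : β → δ → ε) :
    FinitelyValued 𝓐 (fun ω => F (g ω) (h ω)) :=
  (hg.prodMk hh).comp fun p => F p.1 p.2

theorem finset_sum {ι M : Type*} [AddCommMonoid M] (s : Finset ι) {φ : ι → Ω → M}
    (hφ : ∀ i ∈ s, FinitelyValued 𝓐 (φ i)) : FinitelyValued 𝓐 (fun ω => ∑ i ∈ s, φ i ω) := by
  classical
  induction s using Finset.induction_on with
  | empty => simpa using const (0 : M)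
  | insert i s hi ih =>
    simp only [Finset.sum_insert hi]
    exact (hφ i (Finset.mem_insert_self i s)).map₂
      (ih fun j hj => hφ j (Finset.mem_insert_of_mem hj)) (· + ·)

theorem integrable [m0 : MeasurableSpace Ω] {P : Measure Ω} [IsFiniteMeasure P] {g : Ω → ℝ}
    (hg : FinitelyValued m0 g) : Integrable g P :=
  SimpleFunc.integrable_of_isFiniteMeasure (⟨g, hg.2, hg.1⟩ : SimpleFunc Ω ℝ)

theorem integral_comp_eq_sum [m0 : MeasurableSpace Ω] {P : Measure Ω} [IsFiniteMeasure P]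
    (hg : FinitelyValued m0 g) (F : β → ℝ) (T : Finset β) (hT : ∀ᵐ ω ∂P, g ω ∈ T) :
    ∫ ω, F (g ω) ∂P = ∑ y ∈ T, P.real {ω | g ω = y} * F y := by
  classical
  have e : (fun ω => F (g ω)) =ᵐ[P] fun ω => ∑ y ∈ T, {ω | g ω = y}.indicator (fun _ => F y) ω := by
    filter_upwards [hT] with ω hω
    simp only [Set.indicator_apply, Set.mem_ofPred_eq]
    rw [Finset.sum_ite_eq, if_pos hω]
  rw [integral_congr_ae e, integral_finsetSum]
  · exact Finset.sum_congr rfl fun y _ => by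
      rw [integral_indicator_const _ (hg.2 y), smul_eq_mul]
  · exact fun y _ => (integrable_const _).indicator (hg.2 y)

end FinitelyValued

section Uniform

variable {Ω β ι : Type*} {𝓐 : MeasurableSpace Ω} [m0 : MeasurableSpace Ω] {P : Measure Ω}
  [IsProbabilityMeasure P] {g : Ω → β} {X : Ω → ι}

/-- Integrating out a variable that is uniform on the finite set `T` given `𝓐`. -/
theorem integral_of_uniform (h𝓐 : 𝓐 ≤ m0) (hg : FinitelyValued 𝓐 g) (hX : FinitelyValued m0 X)
    {T : Finset ι} (hT : T.Nonempty)
    (hu : ∀ A, MeasurableSet[𝓐] A → ∀ i ∈ T,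
      P.real (A ∩ {ω | X ω = i}) = P.real A * (1 / (T.card : ℝ))) (F : β → ι → ℝ) :
    ∫ ω, F (g ω) (X ω) ∂P = ∫ ω, (1 / (T.card : ℝ)) * ∑ i ∈ T, F (g ω) i ∂P := by
  classical
  have hT0 : (T.card : ℝ) ≠ 0 := by exact_mod_cast hT.card_pos.ne'
  -- With A = `Set.univ` the masses 1/|T| add up to 1, so X lies in T almost surely.
  have hmem : ∀ᵐ ω ∂P, X ω ∈ T := by
    have e : {ω | X ω ∈ T} = ⋃ i ∈ T, {ω | X ω = i} := by
      ext ω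
      simp
    have h1 : P.real {ω | X ω ∈ T} = 1 := by
      rw [e, measureReal_biUnion_finset]
      · have : ∀ i ∈ T, P.real {ω | X ω = i} = 1 / (T.card : ℝ) := by
          intro i hi
          simpa using hu Set.univ MeasurableSet.univ i hi
        rw [Finset.sum_congr rfl this, Finset.sum_const, nsmul_eq_mul, mul_one_div_cancel hT0]
      · intro i _ j _ hij
        rw [Function.onFun, Set.disjoint_left]
        rintro ω rfl h
        exact hij h
      · exact fun i _ => hX.2 i
    have hms : MeasurableSet {ω | X ω ∈ T} := by
      rw [e]
      exact T.measurableSet_biUnion fun i _ => hX.2 i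
    refine (mem_ae_iff_prob_eq_one hms).2 ?_
    rw [measureReal_def] at h1
    rw [← ENNReal.ofReal_toReal (measure_ne_top P _), h1, ENNReal.ofReal_one]
  set R : Finset β := hg.1.toFinset with hR
  have hgR : ∀ ω, g ω ∈ R := fun ω => by simp [hR]
  rw [((hg.mono h𝓐).prodMk hX).integral_comp_eq_sum (fun p => F p.1 p.2) (R ×ˢ T)
      (by filter_upwards [hmem] with ω hω using Finset.mem_product.2 ⟨hgR ω, hω⟩),
    (hg.mono h𝓐).integral_comp_eq_sum (fun y => (1 / (T.card : ℝ)) * ∑ i ∈ T, F y i) R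
      (Filter.Eventually.of_forall hgR), Finset.sum_product]
  refine Finset.sum_congr rfl fun y _ => ?_
  rw [← mul_assoc, Finset.mul_sum]
  refine Finset.sum_congr rfl fun i hi => ?_
  rw [← hu _ (hg.2 y) i hi]
  congr 2
  ext ω
  simp

end Uniform

/-! ### One epoch, path by path. -/

section Path

variable {N : ℕ}

theorem norm_mask_le (A : Finset (Fin N)) (v : EuclideanSpace ℝ (Fin N)) : ‖mask A v‖ ≤ ‖v‖ := by
  rw [← sq_le_sq₀ (norm_nonneg _) (norm_nonneg _), EuclideanSpace.real_norm_sq_eq,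
    EuclideanSpace.real_norm_sq_eq]
  refine Finset.sum_le_sum fun j _ => ?_
  simp only [mask]
  split_ifs
  · exact le_rfl
  · simpa using sq_nonneg (v j)

/-- The constant in the bound of the accumulated squared steps by the accumulated squared mixtured
gradients. -/
noncomputable def stepConst (N : ℕ) (L Lt : ℝ) : ℝ :=
  (2 * (N * L / Lt * Real.exp (N * L / Lt)) ^ 2 + 2) * ((N : ℝ) ^ 2) ^ 2

theorem stepConst_nonneg (N : ℕ) (L Lt : ℝ) : 0 ≤ stepConst N L Lt := by
  unfold stepConst
  positivity

/-- One epoch along a fixed realization of the random inputs. -/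
theorem epoch_path_bound {m τ : ℕ} {γ L Lt ρ : ℝ} (hγ : 0 ≤ γ) (hL : 0 ≤ L) (hLt : 0 < Lt)
    {x xh v : ℕ → EuclideanSpace ℝ (Fin N)} {K : ℕ → Finset ℕ} {keep : ℕ → ℕ → Finset (Fin N)}
    {M g : EuclideanSpace ℝ (Fin N) → EuclideanSpace ℝ (Fin N)}
    (hK : ∀ t < m, ∀ t' ∈ K t, t' < t ∧ t - t' ≤ τ)
    (read : ∀ t < m, x t = xh t - γ • ∑ t' ∈ K t, mask (keep t t') (v t'))
    (update : ∀ t < m, x (t + 1) = x t - γ • v t)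
    (hv : ∀ t < m, ‖v t‖ ≤ (N : ℝ) ^ 2 * (2 * L * ‖xh t - x 0‖ + ‖M (xh t)‖))
    (hM : ∀ x y, ‖M x - M y‖ ≤ Lt * ‖x - y‖) (hg : ∀ x, ‖g x - M x‖ ^ 2 ≤ ρ)
    (hm : 4 * L * (N : ℝ) ^ 2 * γ * m ≤ N * L / Lt)
    (hsmall : ((Lt * γ) ^ 2 * (τ : ℝ) ^ 2 + L * γ / 2) * stepConst N L Lt ≤ 1 / 2) :
    ∑ t ∈ Finset.range m, (-(γ * inner ℝ (g (x t)) (M (xh t))) + L / 2 * (γ ^ 2 * ‖v t‖ ^ 2))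
      ≤ ∑ t ∈ Finset.range m, (γ * ρ - γ / 2 * ‖g (x t)‖ ^ 2) := by
  have hdist : ∀ t ≤ m, ‖x t - x 0‖ ≤ γ * ∑ i ∈ Finset.range t, ‖v i‖ := by
    intro t
    induction t with
    | zero => simp
    | succ t ih =>
      intro ht
      have h1 := ih (by omega)
      rw [update t (by omega), Finset.sum_range_succ, sub_right_comm]
      refine (norm_sub_le _ _).trans ?_
      rw [norm_smul, Real.norm_of_nonneg hγ]
      linarith
  have hread : ∀ t < m, ‖xh t - x t‖ ≤ γ * ∑ i ∈ Finset.Ico (t - τ) t, ‖v i‖ := by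
    intro t ht
    rw [read t ht, sub_sub_cancel, norm_smul, Real.norm_of_nonneg hγ]
    gcongr
    refine (norm_sum_le_of_le _ fun i _ => norm_mask_le _ _).trans ?_
    refine Finset.sum_le_sum_of_subset_of_nonneg (fun i hi => ?_) fun i _ _ => norm_nonneg _
    have := hK t ht i hi
    rw [Finset.mem_Ico]
    omega
  -- 4L = 2L · 2: the delay and the walk away from the snapshot are each at most γ times the sum of
  -- all earlier steps of the epoch.
  have hgron : ∀ t < m, ‖v t‖ ≤ 4 * L * (N : ℝ) ^ 2 * γ * ∑ i ∈ Finset.range t, ‖v i‖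
      + (N : ℝ) ^ 2 * ‖M (xh t)‖ := by
    intro t ht
    have h1 : ∑ i ∈ Finset.Ico (t - τ) t, ‖v i‖ ≤ ∑ i ∈ Finset.range t, ‖v i‖ := by
      refine Finset.sum_le_sum_of_subset_of_nonneg (fun i hi => ?_) fun i _ _ => norm_nonneg _
      exact Finset.mem_range.2 (Finset.mem_Ico.1 hi).2
    have h2 : ‖xh t - x 0‖ ≤ 2 * (γ * ∑ i ∈ Finset.range t, ‖v i‖) := by
      have h3 := norm_sub_le_norm_sub_add_norm_sub (xh t) (x t) (x 0)
      have h4 := hdist t ht.le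
      have h5 := hread t ht
      have h6 := mul_le_mul_of_nonneg_left h1 hγ
      linarith
    calc ‖v t‖ ≤ (N : ℝ) ^ 2 * (2 * L * ‖xh t - x 0‖ + ‖M (xh t)‖) := hv t ht
      _ ≤ (N : ℝ) ^ 2 * (2 * L * (2 * (γ * ∑ i ∈ Finset.range t, ‖v i‖)) + ‖M (xh t)‖) := by
          gcongr
      _ = _ := by ring
  have hsum : ∑ t ∈ Finset.range m, ‖v t‖ ^ 2
      ≤ stepConst N L Lt * ∑ t ∈ Finset.range m, ‖M (xh t)‖ ^ 2 := by
    have h1 := sum_sq_le_of_le_mul_sum_add (by positivity) hm (V := fun t => ‖v t‖)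
      (M := fun t => (N : ℝ) ^ 2 * ‖M (xh t)‖) (fun t => norm_nonneg _)
      (fun t => by positivity) hgron
    simp only [mul_pow, ← Finset.mul_sum] at h1
    simp only [stepConst, mul_pow]
    linarith
  have hdelay : ∑ t ∈ Finset.range m, ‖x t - xh t‖ ^ 2
      ≤ γ ^ 2 * ((τ : ℝ) ^ 2 * ∑ t ∈ Finset.range m, ‖v t‖ ^ 2) := by
    refine le_trans ?_ (mul_le_mul_of_nonneg_left
      (sum_range_sq_sum_Ico_le m τ fun t => ‖v t‖) (sq_nonneg γ))
    rw [Finset.mul_sum]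
    refine Finset.sum_le_sum fun t ht => ?_
    rw [norm_sub_rev, ← mul_pow]
    gcongr
    exact hread t (Finset.mem_range.1 ht)
  -- Polarization, with g (x t) - M (xh t) split at M (x t) into bias and delay.
  have hterm : ∀ t, -(γ * inner ℝ (g (x t)) (M (xh t))) ≤ γ * ρ - γ / 2 * ‖g (x t)‖ ^ 2
      - γ / 2 * ‖M (xh t)‖ ^ 2 + γ * Lt ^ 2 * ‖x t - xh t‖ ^ 2 := by
    intro t
    have h1 := norm_sub_sq_real (g (x t)) (M (xh t))
    have h2 : ‖g (x t) - M (xh t)‖ ^ 2 ≤ 2 * ρ + 2 * (Lt ^ 2 * ‖x t - xh t‖ ^ 2) := by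
      have h3 := norm_sub_le_norm_sub_add_norm_sub (g (x t)) (M (x t)) (M (xh t))
      have h4 : ‖M (x t) - M (xh t)‖ ^ 2 ≤ Lt ^ 2 * ‖x t - xh t‖ ^ 2 := by
        rw [← mul_pow]
        gcongr
        exact hM _ _
      have h5 := hg (x t)
      have h6 : ‖g (x t) - M (xh t)‖ ^ 2
          ≤ (‖g (x t) - M (x t)‖ + ‖M (x t) - M (xh t)‖) ^ 2 := by gcongr
      nlinarith [sq_nonneg (‖g (x t) - M (x t)‖ - ‖M (x t) - M (xh t)‖)]
    have h7 := mul_le_mul_of_nonneg_left h2 hγ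
    rw [h1] at h7
    linarith
  set A := ∑ t ∈ Finset.range m, ‖M (xh t)‖ ^ 2
  set V := ∑ t ∈ Finset.range m, ‖v t‖ ^ 2
  have hA : 0 ≤ A := Finset.sum_nonneg fun t _ => by positivity
  calc ∑ t ∈ Finset.range m, (-(γ * inner ℝ (g (x t)) (M (xh t))) + L / 2 * (γ ^ 2 * ‖v t‖ ^ 2))
      ≤ ∑ t ∈ Finset.range m, ((γ * ρ - γ / 2 * ‖g (x t)‖ ^ 2) - γ / 2 * ‖M (xh t)‖ ^ 2
          + γ * Lt ^ 2 * ‖x t - xh t‖ ^ 2 + L / 2 * γ ^ 2 * ‖v t‖ ^ 2) :=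
        Finset.sum_le_sum fun t _ => by linarith [hterm t]
    _ = ∑ t ∈ Finset.range m, (γ * ρ - γ / 2 * ‖g (x t)‖ ^ 2) - γ / 2 * A
          + γ * Lt ^ 2 * ∑ t ∈ Finset.range m, ‖x t - xh t‖ ^ 2 + L / 2 * γ ^ 2 * V := by
        rw [Finset.sum_add_distrib, Finset.sum_add_distrib, Finset.sum_sub_distrib,
          ← Finset.mul_sum, ← Finset.mul_sum, ← Finset.mul_sum]
    _ ≤ ∑ t ∈ Finset.range m, (γ * ρ - γ / 2 * ‖g (x t)‖ ^ 2) - γ / 2 * A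
          + γ * Lt ^ 2 * (γ ^ 2 * ((τ : ℝ) ^ 2 * V)) + L / 2 * γ ^ 2 * V := by gcongr
    _ = ∑ t ∈ Finset.range m, (γ * ρ - γ / 2 * ‖g (x t)‖ ^ 2) - γ / 2 * A
          + γ * ((Lt * γ) ^ 2 * (τ : ℝ) ^ 2 + L * γ / 2) * V := by ring
    _ ≤ ∑ t ∈ Finset.range m, (γ * ρ - γ / 2 * ‖g (x t)‖ ^ 2) - γ / 2 * A
          + γ * ((Lt * γ) ^ 2 * (τ : ℝ) ^ 2 + L * γ / 2) * (stepConst N L Lt * A) := by gcongr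
    _ = ∑ t ∈ Finset.range m, (γ * ρ - γ / 2 * ‖g (x t)‖ ^ 2) - γ / 2 * A
          + γ * (((Lt * γ) ^ 2 * (τ : ℝ) ^ 2 + L * γ / 2) * stepConst N L Lt) * A := by ring
    -- By `hsmall` the delay and second-order errors are at most (γ/2) A, exactly what polarization
    -- left over.
    _ ≤ ∑ t ∈ Finset.range m, (γ * ρ - γ / 2 * ‖g (x t)‖ ^ 2) - γ / 2 * A
          + γ * (1 / 2) * A := by gcongr
    _ = _ := by ring

end Path

/-! ### The random run: adaptedness, unbiasedness, expected decrease. -/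

section Run

variable {Ω : Type*} [MeasurableSpace Ω] {P : Measure Ω} {N l b Y τ S m : ℕ} {γ L Lt : ℝ}
  {μ : Fin N → ℝ} {f : Fin l → EuclideanSpace ℝ (Fin N) → ℝ} {batches : Finset (Fin b → Fin l)}
  {ℱ : Filtration ℕ (inferInstance : MeasurableSpace Ω)}
  {batch : ℕ → ℕ → Ω → (Fin b → Fin l)} {coords : ℕ → ℕ → Ω → Finset (Fin N)}
  {K : ℕ → ℕ → Ω → Finset ℕ} {keep : ℕ → ℕ → ℕ → Ω → Finset (Fin N)}
  {x0 : EuclideanSpace ℝ (Fin N)} {x xh v : ℕ → ℕ → Ω → EuclideanSpace ℝ (Fin N)}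

theorem finitelyValued_K (hs : IsSchedule P Y τ S m batches ℱ batch coords K keep) {s t : ℕ}
    (hsS : s < S) (ht : t < m) : FinitelyValued (ℱ (s * m + t)) (K s t) := by
  refine ⟨(Finset.finite_toSet (Finset.range t).powerset).subset ?_, hs.K_adapted s hsS t ht⟩
  rintro _ ⟨ω, rfl⟩
  rw [Finset.mem_coe, Finset.mem_powerset]
  exact fun i hi => Finset.mem_range.2 (hs.delay s hsS t ht ω i hi).1

/-- The read is known at time `s * m + t`, the direction only one unit later. This gap allows the
draw to be integrated out while the read is held fixed. -/
theorem finitelyValued_epoch (hs : IsSchedule P Y τ S m batches ℱ batch coords K keep)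
    (hr : IsRun Y S m γ μ f x0 batch coords K keep x xh v) {s : ℕ} (hsS : s < S)
    (h0 : FinitelyValued (ℱ (s * m)) (x s 0)) :
    ∀ t ≤ m, FinitelyValued (ℱ (s * m + t)) (x s t) ∧ ∀ i < t,
      FinitelyValued (ℱ (s * m + i)) (xh s i) ∧ FinitelyValued (ℱ (s * m + i + 1)) (v s i) := by
  intro t
  induction t with
  | zero => exact fun _ => ⟨h0, fun i hi => absurd hi (Nat.not_lt_zero i)⟩
  | succ t ih =>
    intro ht
    obtain ⟨hx, hprev⟩ := ih (by omega)
    have ht' : t < m := by omega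
    have hxh : FinitelyValued (ℱ (s * m + t)) (xh s t) := by
      -- The random index set is traded for the fixed `range t` with indicators; by `hs.delay`
      -- nothing is lost.
      have e : xh s t = fun ω => x s t ω + γ • ∑ i ∈ Finset.range t,
          if i ∈ K s t ω then mask (keep s t i ω) (v s i ω) else 0 := by
        funext ω
        rw [← Finset.sum_filter, hr.read s hsS t ht' ω]
        have : Finset.filter (fun i => i ∈ K s t ω) (Finset.range t) = K s t ω := by
          ext i
          simp only [Finset.mem_filter, Finset.mem_range, and_iff_right_iff_imp]
          exact fun hi => (hs.delay s hsS t ht' ω i hi).1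
        rw [this, sub_add_cancel]
      rw [e]
      refine hx.map₂ (FinitelyValued.finset_sum _ fun i hi => ?_) (fun a c => a + γ • c)
      rw [Finset.mem_range] at hi
      have hk : FinitelyValued (ℱ (s * m + t)) (keep s t i) :=
        ⟨Set.toFinite _, hs.keep_adapted s hsS t ht' i hi⟩
      have hv := (hprev i hi).2.mono (ℱ.mono (by omega : s * m + i + 1 ≤ s * m + t))
      exact (finitelyValued_K hs hsS ht').map₂ (hk.prodMk hv)
        (fun A p => if i ∈ A then mask p.1 p.2 else 0)
    have hle : ℱ (s * m + t) ≤ ℱ (s * m + t + 1) := ℱ.mono (by omega)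
    have hv : FinitelyValued (ℱ (s * m + t + 1)) (v s t) := by
      have hB : FinitelyValued (ℱ (s * m + t + 1)) (batch s t) :=
        ⟨Set.toFinite _, hs.batch_adapted s hsS t ht'⟩
      have hJ : FinitelyValued (ℱ (s * m + t + 1)) (coords s t) :=
        ⟨Set.toFinite _, hs.coords_adapted s hsS t ht'⟩
      have e : v s t = fun ω =>
          direction Y μ f (batch s t ω) (coords s t ω) (xh s t ω) (x s 0 ω) :=
        funext fun ω => hr.compute s hsS t ht' ω
      rw [e]
      exact (hB.prodMk hJ).map₂ ((hxh.mono hle).prodMk (h0.mono (ℱ.mono (by omega))))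
        (fun p q => direction Y μ f p.1 p.2 q.1 q.2)
    refine ⟨?_, fun i hi => ?_⟩
    · have e : x s (t + 1) = fun ω => x s t ω - γ • v s t ω :=
        funext fun ω => hr.update s hsS t ht' ω
      rw [e]
      exact (hx.mono hle).map₂ hv (fun a c => a - γ • c)
    · rcases Nat.lt_succ_iff_lt_or_eq.1 hi with h | rfl
      · exact hprev i h
      · exact ⟨hxh, hv⟩

theorem finitelyValued_start (hs : IsSchedule P Y τ S m batches ℱ batch coords K keep)
    (hr : IsRun Y S m γ μ f x0 batch coords K keep x xh v) :
    ∀ s ≤ S, FinitelyValued (ℱ (s * m)) (x s 0) := by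
  intro s
  induction s with
  | zero =>
    intro _
    have e : x 0 0 = fun _ => x0 := funext hr.init
    rw [e]
    exact FinitelyValued.const x0
  | succ s ih =>
    intro h
    have e : x (s + 1) 0 = x s m := funext fun ω => hr.epoch s h ω
    rw [e, Nat.succ_mul]
    exact (finitelyValued_epoch hs hr h (ih (by omega)) m le_rfl).1

variable [IsProbabilityMeasure P]

/-- Given the past, the iterate, the read and the snapshot are fixed and the draw is uniform, so
`sum_sum_direction` replaces v by its mean. -/
theorem integral_inner_direction (hb : b ≠ 0) (hbl : b ≤ l) (hY : 1 ≤ Y) (hYN : Y ≤ N)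
    (hf : ∀ i, Differentiable ℝ (f i)) (hB : IsBatchSpace batches)
    (hs : IsSchedule P Y τ S m batches ℱ batch coords K keep)
    (hr : IsRun Y S m γ μ f x0 batch coords K keep x xh v) {s t : ℕ} (hsS : s < S) (ht : t < m)
    (φ : EuclideanSpace ℝ (Fin N) → EuclideanSpace ℝ (Fin N)) :
    ∫ ω, inner ℝ (φ (x s t ω)) (v s t ω) ∂P
      = ∫ ω, inner ℝ (φ (x s t ω)) (mixedGrad μ (avg f) (xh s t ω)) ∂P := by
  have h0 := finitelyValued_start hs hr s hsS.le
  have hx := (finitelyValued_epoch hs hr hsS h0 t ht.le).1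
  have hxh := ((finitelyValued_epoch hs hr hsS h0 (t + 1) ht).2 t (Nat.lt_succ_self t)).1
  have hne : (batches ×ˢ Finset.powersetCard Y (Finset.univ : Finset (Fin N))).Nonempty :=
    (hB.nonempty hbl).product (Finset.powersetCard_nonempty.2 (by simpa using hYN))
  have hcard : ((batches ×ˢ Finset.powersetCard Y (Finset.univ : Finset (Fin N))).card : ℝ)
      = (batches.card : ℝ) * (N.choose Y : ℝ) := by
    rw [Finset.card_product, Finset.card_powersetCard, Finset.card_univ, Fintype.card_fin,
      Nat.cast_mul]
  have hX : FinitelyValued (ℱ (s * m + t + 1)) (fun ω => (batch s t ω, coords s t ω)) :=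
    FinitelyValued.prodMk ⟨Set.toFinite _, hs.batch_adapted s hsS t ht⟩
      ⟨Set.toFinite _, hs.coords_adapted s hsS t ht⟩
  have key := integral_of_uniform (P := P) (ℱ.le (s * m + t))
    (hx.prodMk (hxh.prodMk (h0.mono (ℱ.mono (by omega : s * m ≤ s * m + t)))))
    (hX.mono (ℱ.le _)) hne ?_
    (fun p i => inner ℝ (φ p.1) (direction Y μ f i.1 i.2 p.2.1 p.2.2))
  · simp only [hr.compute s hsS t ht]
    refine key.trans (integral_congr_ae (Filter.Eventually.of_forall fun ω => ?_))
    have hc0 : (batches.card : ℝ) * (N.choose Y : ℝ) ≠ 0 := by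
      rw [← hcard]
      exact_mod_cast hne.card_pos.ne'
    simp only [hcard]
    rw [Finset.sum_product]
    simp only [← inner_sum]
    rw [sum_sum_direction hb (by omega) hY hYN hf hB, real_inner_smul_right, ← mul_assoc,
      one_div_mul_cancel hc0, one_mul]
  · rintro A hA ⟨B, J⟩ hi
    rw [Finset.mem_product, Finset.mem_powersetCard] at hi
    simp only [Prod.mk.injEq]
    rw [hcard, hs.uniform s hsS t ht A hA B hi.1 J hi.2.2, mul_assoc, one_div_mul_one_div]

/-- The expected decrease of the objective over one epoch. -/
theorem integral_epoch_le (hb : b ≠ 0) (hbl : b ≤ l) (hY : 1 ≤ Y) (hYN : Y ≤ N)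
    (hγ : 0 ≤ γ) (hL0 : 0 ≤ L) (hLt : 0 < Lt) (hμ : ∀ j, 0 < μ j)
    (hf : ∀ i, Differentiable ℝ (f i))
    (hL : ∀ i x y, ‖gradient (f i) x - gradient (f i) y‖ ≤ L * ‖x - y‖)
    (hM : ∀ x y, ‖mixedGrad μ (avg f) x - mixedGrad μ (avg f) y‖ ≤ Lt * ‖x - y‖)
    (hm : γ * m ≤ Y / (5 * Lt * (N : ℝ) ^ 2))
    (hsmall : ((Lt * γ) ^ 2 * (τ : ℝ) ^ 2 + L * γ / 2) * stepConst N L Lt ≤ 1 / 2)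
    (hB : IsBatchSpace batches)
    (hs : IsSchedule P Y τ S m batches ℱ batch coords K keep)
    (hr : IsRun Y S m γ μ f x0 batch coords K keep x xh v) {s : ℕ} (hsS : s < S) :
    ∫ ω, avg f (x (s + 1) 0 ω) ∂P ≤ ∫ ω, avg f (x s 0 ω) ∂P
      + (m * (γ * (N * smoothingBias L μ / 4))
        - γ / 2 * ∑ t ∈ Finset.range m, ∫ ω, ‖gradient (avg f) (x s t ω)‖ ^ 2 ∂P) := by
  have hl : l ≠ 0 := by omega
  have hfd := differentiable_avg hf
  have hfL := norm_gradient_avg_sub_le hl hf hL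
  have h0 := finitelyValued_start hs hr s hsS.le
  have hle : ∀ n, ℱ n ≤ (inferInstance : MeasurableSpace Ω) := ℱ.le
  have hx : ∀ t ≤ m, FinitelyValued (inferInstance : MeasurableSpace Ω) (x s t) := fun t ht =>
    (finitelyValued_epoch hs hr hsS h0 t ht).1.mono (hle _)
  have hxh : ∀ t < m, FinitelyValued (inferInstance : MeasurableSpace Ω) (xh s t) := fun t ht =>
    ((finitelyValued_epoch hs hr hsS h0 (t + 1) ht).2 t (Nat.lt_succ_self t)).1.mono (hle _)
  have hv : ∀ t < m, FinitelyValued (inferInstance : MeasurableSpace Ω) (v s t) := fun t ht =>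
    ((finitelyValued_epoch hs hr hsS h0 (t + 1) ht).2 t (Nat.lt_succ_self t)).2.mono (hle _)
  have if0 : ∀ t ≤ m, Integrable (fun ω => avg f (x s t ω)) P := fun t ht =>
    ((hx t ht).comp (avg f)).integrable
  have ig : ∀ t < m, Integrable (fun ω => ‖gradient (avg f) (x s t ω)‖ ^ 2) P := fun t ht =>
    ((hx t ht.le).comp fun y => ‖gradient (avg f) y‖ ^ 2).integrable
  have iv : ∀ t < m, Integrable (fun ω => L / 2 * (γ ^ 2 * ‖v s t ω‖ ^ 2)) P := fun t ht =>
    ((hv t ht).comp fun y => L / 2 * (γ ^ 2 * ‖y‖ ^ 2)).integrable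
  have igv : ∀ t < m,
      Integrable (fun ω => -(γ * inner ℝ (gradient (avg f) (x s t ω)) (v s t ω))) P :=
    fun t ht => ((hx t ht.le).map₂ (hv t ht)
      fun y z => -(γ * inner ℝ (gradient (avg f) y) z)).integrable
  have igm : ∀ t < m, Integrable (fun ω =>
      -(γ * inner ℝ (gradient (avg f) (x s t ω)) (mixedGrad μ (avg f) (xh s t ω)))) P :=
    fun t ht => ((hx t ht.le).map₂ (hxh t ht)
      fun y z => -(γ * inner ℝ (gradient (avg f) y) (mixedGrad μ (avg f) z))).integrable
  have igv' : ∀ t < m, Integrable (fun ω =>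
      -(γ * inner ℝ (gradient (avg f) (x s t ω)) (v s t ω)) + L / 2 * (γ ^ 2 * ‖v s t ω‖ ^ 2)) P :=
    fun t ht => (igv t ht).add (iv t ht)
  have igm' : ∀ t ∈ Finset.range m, Integrable (fun ω =>
      -(γ * inner ℝ (gradient (avg f) (x s t ω)) (mixedGrad μ (avg f) (xh s t ω)))
        + L / 2 * (γ ^ 2 * ‖v s t ω‖ ^ 2)) P :=
    fun t ht => (igm t (Finset.mem_range.1 ht)).add (iv t (Finset.mem_range.1 ht))
  have hstep : ∀ t < m, ∫ ω, avg f (x s (t + 1) ω) ∂P ≤ ∫ ω, avg f (x s t ω) ∂P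
      + ∫ ω, (-(γ * inner ℝ (gradient (avg f) (x s t ω)) (mixedGrad μ (avg f) (xh s t ω)))
        + L / 2 * (γ ^ 2 * ‖v s t ω‖ ^ 2)) ∂P := by
    intro t ht
    rw [integral_add (igm t ht) (iv t ht)]
    -- Unbiasedness is needed for the cross term only; ‖v‖² stays and is bounded pathwise.
    have e : ∫ ω, -(γ * inner ℝ (gradient (avg f) (x s t ω)) (mixedGrad μ (avg f) (xh s t ω))) ∂P
        = ∫ ω, -(γ * inner ℝ (gradient (avg f) (x s t ω)) (v s t ω)) ∂P := by
      rw [integral_neg, integral_neg, integral_const_mul, integral_const_mul,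
        integral_inner_direction hb hbl hY hYN hf hB hs hr hsS ht]
    rw [e, ← integral_add (igv t ht) (iv t ht),
      ← integral_add (if0 t ht.le) (igv' t ht)]
    refine integral_mono (if0 (t + 1) ht)
      ((if0 t ht.le).add (igv' t ht)) fun ω => ?_
    have h1 := (abs_le.1 (abs_sub_sub_inner_gradient_le hfd hfL (x s t ω) (-(γ • v s t ω)))).2
    rw [← sub_eq_add_neg, ← hr.update s hsS t ht ω, inner_neg_right, real_inner_smul_right,
      norm_neg, norm_smul, mul_pow, Real.norm_eq_abs, sq_abs] at h1
    show avg f (x s (t + 1) ω) ≤ avg f (x s t ω)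
      + (-(γ * inner ℝ (gradient (avg f) (x s t ω)) (v s t ω)) + L / 2 * (γ ^ 2 * ‖v s t ω‖ ^ 2))
    linarith
  have htel : ∀ t ≤ m, ∫ ω, avg f (x s t ω) ∂P ≤ ∫ ω, avg f (x s 0 ω) ∂P
      + ∑ i ∈ Finset.range t,
        ∫ ω, (-(γ * inner ℝ (gradient (avg f) (x s i ω)) (mixedGrad μ (avg f) (xh s i ω)))
        + L / 2 * (γ ^ 2 * ‖v s i ω‖ ^ 2)) ∂P := by
    intro t
    induction t with
    | zero => simp
    | succ t ih =>
      intro ht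
      rw [Finset.sum_range_succ]
      linarith [ih (by omega), hstep t ht]
  have hN : (0 : ℝ) < N := by exact_mod_cast (by omega : 0 < N)
  -- NL/L̃ is the Gronwall exponent R built into `stepConst`.
  have hm' : 4 * L * (N : ℝ) ^ 2 * γ * m ≤ N * L / Lt := by
    calc 4 * L * (N : ℝ) ^ 2 * γ * m = 4 * L * (N : ℝ) ^ 2 * (γ * m) := by ring
      _ ≤ 4 * L * (N : ℝ) ^ 2 * (Y / (5 * Lt * (N : ℝ) ^ 2)) := by gcongr
      _ = 4 / 5 * (Y * L / Lt) := by field_simp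
      _ ≤ 1 * (N * L / Lt) := by
          gcongr
          norm_num
      _ = _ := one_mul _
  have hpath : ∀ ω, ∑ t ∈ Finset.range m,
      (-(γ * inner ℝ (gradient (avg f) (x s t ω)) (mixedGrad μ (avg f) (xh s t ω)))
        + L / 2 * (γ ^ 2 * ‖v s t ω‖ ^ 2))
      ≤ ∑ t ∈ Finset.range m, (γ * (N * smoothingBias L μ / 4)
        - γ / 2 * ‖gradient (avg f) (x s t ω)‖ ^ 2) := fun ω =>
    epoch_path_bound (x := fun t => x s t ω) (xh := fun t => xh s t ω) (v := fun t => v s t ω)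
      (K := fun t => K s t ω) (keep := fun t i => keep s t i ω) hγ hL0 hLt
      (fun t ht => hs.delay s hsS t ht ω) (fun t ht => hr.read s hsS t ht ω)
      (fun t ht => hr.update s hsS t ht ω)
      (fun t ht => by
        rw [hr.compute s hsS t ht ω]
        exact norm_direction_le hb hl hY hμ hf hL0 hL _ _ _ _)
      hM (norm_sq_gradient_sub_mixedGrad_le hμ hfd hfL) hm' hsmall
  have e : x (s + 1) 0 = x s m := funext fun ω => hr.epoch s hsS ω
  rw [e]
  refine (htel m le_rfl).trans (add_le_add le_rfl ?_)
  rw [← integral_finsetSum _ igm']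
  have ir : ∀ t ∈ Finset.range m, Integrable (fun ω => γ * (N * smoothingBias L μ / 4)
      - γ / 2 * ‖gradient (avg f) (x s t ω)‖ ^ 2) P := fun t ht =>
    (integrable_const _).sub ((ig t (Finset.mem_range.1 ht)).const_mul _)
  refine (integral_mono (integrable_finsetSum _ igm') (integrable_finsetSum _ ir) hpath).trans_eq ?_
  rw [integral_finsetSum _ ir]
  have e2 : ∀ t ∈ Finset.range m, ∫ ω, (γ * (N * smoothingBias L μ / 4)
      - γ / 2 * ‖gradient (avg f) (x s t ω)‖ ^ 2) ∂P = γ * (N * smoothingBias L μ / 4)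
      - γ / 2 * ∫ ω, ‖gradient (avg f) (x s t ω)‖ ^ 2 ∂P := by
    intro t ht
    rw [integral_sub (integrable_const _) ((ig t (Finset.mem_range.1 ht)).const_mul _)]
    congr 1
    · simp
    · exact integral_const_mul _ _
  rw [Finset.sum_congr rfl e2, Finset.sum_sub_distrib, Finset.sum_const, Finset.card_range,
    nsmul_eq_mul, ← Finset.mul_sum]

theorem integrable_run (hs : IsSchedule P Y τ S m batches ℱ batch coords K keep)
    (hr : IsRun Y S m γ μ f x0 batch coords K keep x xh v) :
    (∀ s < S, ∀ t < m, Integrable (fun ω => ‖gradient (avg f) (x s t ω)‖ ^ 2) P) ∧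
      Integrable (fun ω => avg f (x S 0 ω)) P := by
  refine ⟨fun s hsS t ht => ?_, ?_⟩
  · have := (finitelyValued_epoch hs hr hsS (finitelyValued_start hs hr s hsS.le) t ht.le).1
    exact ((this.mono (ℱ.le _)).comp fun y => ‖gradient (avg f) y‖ ^ 2).integrable
  · exact (((finitelyValued_start hs hr S le_rfl).mono (ℱ.le _)).comp (avg f)).integrable

/-- The bound for the whole run. The variance of the directions is absorbed by the negative multiple
of `‖mixedGrad‖²` left over by polarization, so the full coefficient `γ / 2` remains. -/
theorem integral_run_le (hb : b ≠ 0) (hbl : b ≤ l) (hY : 1 ≤ Y) (hYN : Y ≤ N)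
    (hγ : 0 ≤ γ) (hL0 : 0 ≤ L) (hLt : 0 < Lt) (hμ : ∀ j, 0 < μ j)
    (hf : ∀ i, Differentiable ℝ (f i))
    (hL : ∀ i x y, ‖gradient (f i) x - gradient (f i) y‖ ≤ L * ‖x - y‖)
    (hM : ∀ x y, ‖mixedGrad μ (avg f) x - mixedGrad μ (avg f) y‖ ≤ Lt * ‖x - y‖)
    (hm : γ * m ≤ Y / (5 * Lt * (N : ℝ) ^ 2))
    (hsmall : ((Lt * γ) ^ 2 * (τ : ℝ) ^ 2 + L * γ / 2) * stepConst N L Lt ≤ 1 / 2)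
    (hB : IsBatchSpace batches)
    (hs : IsSchedule P Y τ S m batches ℱ batch coords K keep)
    (hr : IsRun Y S m γ μ f x0 batch coords K keep x xh v) :
    γ / 2 * ∑ s ∈ Finset.range S, ∑ t ∈ Finset.range m,
        ∫ ω, ‖gradient (avg f) (x s t ω)‖ ^ 2 ∂P
      ≤ avg f x0 - ∫ ω, avg f (x S 0 ω) ∂P
        + ((S * m : ℕ) : ℝ) * (γ * (N * smoothingBias L μ / 4)) := by
  have key : ∀ n ≤ S, γ / 2 * ∑ s ∈ Finset.range n, ∑ t ∈ Finset.range m,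
        ∫ ω, ‖gradient (avg f) (x s t ω)‖ ^ 2 ∂P
      ≤ avg f x0 - ∫ ω, avg f (x n 0 ω) ∂P
        + (n * m : ℝ) * (γ * (N * smoothingBias L μ / 4)) := by
    intro n
    induction n with
    | zero => simp [hr.init]
    | succ n ih =>
      intro hn
      have h1 := ih (by omega)
      have h2 := integral_epoch_le hb hbl hY hYN hγ hL0 hLt hμ hf hL hM hm hsmall hB hs hr hn
      rw [Finset.sum_range_succ, mul_add]
      push_cast
      linarith
  push_cast
  exact key S le_rfl

end Run

end AsyDSZOVR

/-! ### Choice of constants and conclusion. -/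

theorem theorem2 (N Y τ : ℕ) (hY : 1 ≤ Y) (hYN : Y ≤ N)
    (L Lt Lh : ℝ) (hL : 0 ≤ L) (hLt : 0 < Lt) (hLh : 0 ≤ Lh) :
    ∃ uStar : ℝ, 0 < uStar ∧ uStar < 1 ∧ ∀ u0 : ℝ, 0 < u0 → u0 ≤ uStar →
    ∃ σ0 : ℝ, 0 < σ0 ∧
      ∀ (α : ℝ), 0 < α → α < 1 →
      ∀ (l b m : ℕ), 1 ≤ b → (b : ℝ) < (l : ℝ) ^ α →
      1 ≤ m → (m : ℝ) ≤ Y * (l : ℝ) ^ α / (5 * u0 * b * (N : ℝ) ^ 2) →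
      ∀ (γ : ℝ), γ = u0 * b / (Lt * (l : ℝ) ^ α) →
      ∀ (β c : ℕ → ℝ), (∀ t, β t = Lt * (N : ℝ) ^ 2 / Y) →
        AsyDSZOVR.IsCoeff N Y τ b m L Lt γ β c →
        -- the constant σ may be chosen independently of l, b, α, m
        (0 < AsyDSZOVR.gap N Y τ Lt γ ∧
          ∀ t < m, σ0 * b / (Lt * (l : ℝ) ^ α) ≤ AsyDSZOVR.Gam N Y τ L Lt Lh γ c t) ∧
        -- the bound
        ∀ (σ : ℝ), 0 < σ →
          (∀ t < m, σ * b / (Lt * (l : ℝ) ^ α) ≤ AsyDSZOVR.Gam N Y τ L Lt Lh γ c t) →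
        ∀ (μ : Fin N → ℝ), (∀ j, 0 < μ j) →
        ∀ (f : Fin l → EuclideanSpace ℝ (Fin N) → ℝ),
          (∀ i, Differentiable ℝ (f i)) →
          (∀ i x y, ‖gradient (f i) x - gradient (f i) y‖ ≤ L * ‖x - y‖) →
          (∀ x y, ‖AsyDSZOVR.mixedGrad μ (AsyDSZOVR.avg f) x
            - AsyDSZOVR.mixedGrad μ (AsyDSZOVR.avg f) y‖ ≤ Lt * ‖x - y‖) →
          (∀ x, ‖AsyDSZOVR.mixedGrad μ (AsyDSZOVR.avg f) x‖
            ≤ Lh * ‖gradient (AsyDSZOVR.avg f) x‖) →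
        ∀ {Ω : Type*} [MeasurableSpace Ω] (P : Measure Ω) [IsProbabilityMeasure P]
          (S : ℕ) (_ : 1 ≤ S) (batches : Finset (Fin b → Fin l))
          (_ : AsyDSZOVR.IsBatchSpace batches)
          (ℱ : Filtration ℕ (inferInstance : MeasurableSpace Ω))
          (batch : ℕ → ℕ → Ω → (Fin b → Fin l)) (coords : ℕ → ℕ → Ω → Finset (Fin N))
          (K : ℕ → ℕ → Ω → Finset ℕ) (keep : ℕ → ℕ → ℕ → Ω → Finset (Fin N))
          (x0 : EuclideanSpace ℝ (Fin N)) (x xh v : ℕ → ℕ → Ω → EuclideanSpace ℝ (Fin N)),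
          AsyDSZOVR.IsSchedule P Y τ S m batches ℱ batch coords K keep →
          AsyDSZOVR.IsRun Y S m γ μ f x0 batch coords K keep x xh v →
          (∀ s < S, ∀ t < m,
            Integrable (fun ω => ‖gradient (AsyDSZOVR.avg f) (x s t ω)‖ ^ 2) P) ∧
          Integrable (fun ω => AsyDSZOVR.avg f (x S 0 ω)) P ∧
          1 / ((S * m : ℕ) : ℝ) * ∑ s ∈ Finset.range S, ∑ t ∈ Finset.range m,
              ∫ ω, ‖gradient (AsyDSZOVR.avg f) (x s t ω)‖ ^ 2 ∂P
            ≤ Lt * (l : ℝ) ^ α * (AsyDSZOVR.avg f x0 - ∫ ω, AsyDSZOVR.avg f (x S 0 ω) ∂P)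
                / (σ * b * ((S * m : ℕ) : ℝ))
              + N * u0 * AsyDSZOVR.smoothingBias L μ / (4 * σ) := by
  have hN : (1 : ℝ) ≤ N := by exact_mod_cast hY.trans hYN
  set C := AsyDSZOVR.stepConst N L Lt
  have hC : 0 ≤ C := AsyDSZOVR.stepConst_nonneg N L Lt
  -- A₁ keeps the gap at least Y/2, A₂ gives Γ_t ≥ γ/4, and A₃ gives the absorption in
  -- `epoch_path_bound`; the 16 below ensures u₀ ≤ 3/16 and u* < 1.
  set A₁ : ℝ := 4 * N * (τ : ℝ) ^ 2
  set A₂ : ℝ := 32 * Lh * (5 * N * (L + N * L ^ 2 * (τ : ℝ) ^ 2 / Lt)) / Lt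
  set A₃ : ℝ := 2 * (((τ : ℝ) ^ 2 + L / (2 * Lt)) * C)
  have hA₁ : 0 ≤ A₁ := by positivity
  have hA₂ : 0 ≤ A₂ := by positivity
  have hA₃ : 0 ≤ A₃ := by positivity
  refine ⟨1 / (16 + A₁ + A₂ + A₃), by positivity, ?_, fun u0 hu0 hu => ?_⟩
  · rw [div_lt_one (by positivity)]
    linarith
  rw [le_div_iff₀ (by positivity)] at hu
  have hu1 : u0 ≤ 3 / 16 := by nlinarith
  have hu₁ : u0 * A₁ ≤ 1 := le_trans (by gcongr; linarith) hu
  have hu₂ : u0 * A₂ ≤ 1 := le_trans (by gcongr; linarith) hu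
  have hu₃ : u0 * A₃ ≤ 1 := le_trans (by gcongr; linarith) hu
  refine ⟨u0 / 4, by positivity, fun α hα0 hα1 l b m hb hbl hm1 hm γ hγ β c hβ hc => ?_⟩
  have hb' : (1 : ℝ) ≤ b := by exact_mod_cast hb
  have hl0 : l ≠ 0 := by
    rintro rfl
    rw [Nat.cast_zero, Real.zero_rpow hα0.ne'] at hbl
    linarith
  have hl1 : (1 : ℝ) ≤ l := by exact_mod_cast Nat.one_le_iff_ne_zero.2 hl0
  -- Guarantees that batches without replacement exist.
  have hble : b ≤ l := by
    have : (l : ℝ) ^ α ≤ l := by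
      simpa using Real.rpow_le_rpow_of_exponent_le hl1 hα1.le
    exact_mod_cast hbl.le.trans this
  set q : ℝ := (l : ℝ) ^ α with hq
  have hq0 : 0 < q := by linarith
  have hγ0 : 0 < γ := by rw [hγ]; positivity
  have hγu : Lt * γ ≤ u0 := by
    have : Lt * γ = u0 * (b / q) := by rw [hγ]; field_simp
    rw [this]
    exact mul_le_of_le_one_right hu0.le ((div_le_one hq0).2 hbl.le)
  have hγm : γ * m ≤ Y / (5 * Lt * (N : ℝ) ^ 2) := by
    calc γ * m ≤ γ * (Y * q / (5 * u0 * b * (N : ℝ) ^ 2)) := by gcongr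
      _ = Y / (5 * Lt * (N : ℝ) ^ 2) := by rw [hγ]; field_simp
  have hgap : 0 < AsyDSZOVR.gap N Y τ Lt γ :=
    lt_of_lt_of_le (by positivity)
      (AsyDSZOVR.half_le_gap hY hLt hγ0.le (hu1.trans (by norm_num)) hγu hu₁)
  refine ⟨⟨hgap, fun t ht => ?_⟩, ?_⟩
  · have h1 := AsyDSZOVR.quarter_le_Gam hY hYN hL hLt hLh hb hγ0.le hu1 hγu hu₁ hu₂ hγm hβ hc ht
    have e : u0 / 4 * b / (Lt * q) = γ / 4 := by rw [hγ]; ring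
    rw [e]
    exact h1
  intro σ hσ hσΓ μ hμ f hf hfL hML _ Ω _ P _ S hS batches hB ℱ batch coords K keep x0 x xh v hs hr
  obtain ⟨hi1, hi2⟩ := AsyDSZOVR.integrable_run hs hr
  refine ⟨hi1, hi2, ?_⟩
  have hsmall : ((Lt * γ) ^ 2 * (τ : ℝ) ^ 2 + L * γ / 2) * C ≤ 1 / 2 := by
    have h0 : 0 ≤ Lt * γ := by positivity
    have h1 : (Lt * γ) ^ 2 ≤ u0 := by nlinarith
    have h2 : L * γ / 2 ≤ u0 * (L / (2 * Lt)) := by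
      have : L * γ / 2 = Lt * γ * (L / (2 * Lt)) := by field_simp
      rw [this]
      gcongr
    calc ((Lt * γ) ^ 2 * (τ : ℝ) ^ 2 + L * γ / 2) * C
        ≤ (u0 * (τ : ℝ) ^ 2 + u0 * (L / (2 * Lt))) * C := by gcongr
      _ = u0 * A₃ / 2 := by ring
      _ ≤ 1 / 2 := by gcongr
  have hrun := AsyDSZOVR.integral_run_le (by omega) hble hY hYN hγ0.le hL hLt hμ hf hfL hML hγm
    hsmall hB hs hr
  -- Only t = 0 is used, available because m ≥ 1: c_1 ≥ 0 makes the term subtracted in Γ_0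
  -- nonnegative.
  have hσγ : σ * b / (Lt * q) ≤ γ / 2 := by
    refine (hσΓ 0 hm1).trans (AsyDSZOVR.Gam_le_half hL hLh hγ0.le hgap ?_)
    exact (AsyDSZOVR.coeff_bound hY hYN hL hLt hb hγ0.le hu1 hγu hu₁ hγm hβ hc 1 hm1).1
  set W := ∑ s ∈ Finset.range S, ∑ t ∈ Finset.range m,
    ∫ ω, ‖gradient (AsyDSZOVR.avg f) (x s t ω)‖ ^ 2 ∂P
  have hW : 0 ≤ W := Finset.sum_nonneg fun s _ => Finset.sum_nonneg fun t _ =>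
    integral_nonneg fun ω => sq_nonneg _
  have hT : (0 : ℝ) < ((S * m : ℕ) : ℝ) := by
    exact_mod_cast Nat.mul_pos (by omega) (by omega)
  set T : ℝ := ((S * m : ℕ) : ℝ)
  set Δ := AsyDSZOVR.avg f x0 - ∫ ω, AsyDSZOVR.avg f (x S 0 ω) ∂P
  have hfin : σ * b / (Lt * q) * W ≤ Δ + T * (γ * (N * AsyDSZOVR.smoothingBias L μ / 4)) :=
    (mul_le_mul_of_nonneg_right hσγ hW).trans hrun
  have hk : 0 < Lt * q / (σ * b * T) := by positivity
  calc 1 / T * W = Lt * q / (σ * b * T) * (σ * b / (Lt * q) * W) := by field_simp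
    _ ≤ Lt * q / (σ * b * T) * (Δ + T * (γ * (N * AsyDSZOVR.smoothingBias L μ / 4))) := by gcongr
    _ = Lt * q * Δ / (σ * b * T) + N * u0 * AsyDSZOVR.smoothingBias L μ / (4 * σ) := by
        rw [hγ]
        field_simp
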